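/- Let $F$ be a field of characteristic $3$, let $\alpha,\beta,\gamma,\delta\in F$ with $\alpha\neq 0$ and $\beta\neq 0$, put $f(a,b)=\alpha a^3+\beta a^2b+\gamma ab^2+\delta b^3$ and $\Phi(z,a,b)=z^3-f(a,b)$, and let $$C_\Phi=F\langle x,y : (ax+by)^3=f(a,b)\ \text{ for all } a,b\in F\rangle$$ be the Clifford algebra of $\Phi$. With $[u,v]=uv-vu$, define in $C_\Phi$ $$y_1=[x,y]+[x,[x,y]],\qquad y_2=y+y_1,\qquad w=\beta y_2+\gamma x+y_1^2 .$$ Let $\Delta=-\gamma^3\alpha+\gamma^2\beta^2-\beta^3\delta+\beta^6\in F$, and let $E_\Delta$ be the affine curve $s^2=r^3+\Delta$, with coordinate ring $F[r,s]=F[R,S]/(S^2-R^3-\Delta)$. For a commutative ring $K$ and $a,b\in K$ write $$[a,b)_{3,K}=K\langle u,v : u^3-u=a,\ v^3=b,\ vu-uv=v\rangle .$$ Then: 1. $C_\Phi$ is an Azumaya algebra of constant rank $9$ over its center. 2. The center of $C_\Phi$ is the subalgebra $F[w,y_1^3]$, and there is an isomorphism of $F$-algebras from $F[r,s]$ to the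 center sending $r\mapsto w$ and $s\mapsto y_1^3-\beta^3$. 3. Let $\bar F$ be an algebraic closure of $F$. There is a one-to-one correspondence between the orbits of $\mathrm{Aut}(\bar F/F)$ on the $\bar F$-rational points of $E_\Delta$ (singular points included) and the simple homomorphic images of $C_\Phi$ (that is, the quotients of $C_\Phi$ by two-sided ideals that are simple rings), such that for every point $(r_0,s_0)$ the image corresponding to its orbit is isomorphic, as an $F$-algebra, to the cyclic algebra $$[\alpha\beta^{-3}(s_0+\beta^3),\ \alpha)_{3,\,F[r_0,s_0]},$$ which is a central simple algebra of degree $3$ (dimension $9$) over the field $F[r_0,s_0]\subseteq\bar F$; the isomorphism can be chosen to send the images of $w$ and $y_1^3-\beta^3$ to $r_0$ and $s_0$. -/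

import Mathlib

/-- Defining relations of the Clifford algebra of the monic polynomial
`Φ(z, a, b) = z ^ 3 - f(a, b)`, where `f(a, b) = α a ^ 3 + β a ^ 2 b + γ a b ^ 2 + δ b ^ 3`:
`(a x + b y) ^ 3 = f(a, b)` for all `a, b ∈ F`. The generators `x, y` are indexed by `0, 1`. -/
inductive CliffordRel {F : Type*} [Field F] (α β γ δ : F) :
    FreeAlgebra F (Fin 2) → FreeAlgebra F (Fin 2) → Prop
  | rel (a b : F) : CliffordRel α β γ δ
      ((a • FreeAlgebra.ι F 0 + b • FreeAlgebra.ι F 1) ^ 3)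
      (algebraMap F (FreeAlgebra F (Fin 2))
        (α * a ^ 3 + β * a ^ 2 * b + γ * a * b ^ 2 + δ * b ^ 3))

/-- The Clifford algebra `C_Φ` of `Φ = z ^ 3 - (α a ^ 3 + β a ^ 2 b + γ a b ^ 2 + δ b ^ 3)`. -/
abbrev CPhi {F : Type*} [Field F] (α β γ δ : F) : Type _ :=
  RingQuot (CliffordRel α β γ δ)

namespace CPhi

variable {F : Type*} [Field F] (α β γ δ : F)

/-- The generator `x` of `C_Φ`. -/
noncomputable def x : CPhi α β γ δ :=
  RingQuot.mkAlgHom F (CliffordRel α β γ δ) (FreeAlgebra.ι F 0)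

/-- The generator `y` of `C_Φ`. -/
noncomputable def y : CPhi α β γ δ :=
  RingQuot.mkAlgHom F (CliffordRel α β γ δ) (FreeAlgebra.ι F 1)

/-- `y₁ = [x, y] + [x, [x, y]]`. In characteristic `3`, the elements `y₁` and `y₂ = y + y₁` are the
unique ones with `y = y₂ - y₁`, `x y₂ - y₂ x = y₁` and `x y₁ - y₁ x` commuting with `x`. -/
noncomputable def y₁ : CPhi α β γ δ :=
  ⁅x α β γ δ, y α β γ δ⁆ + ⁅x α β γ δ, ⁅x α β γ δ, y α β γ δ⁆⁆

/-- `y₂ = y + y₁`. -/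
noncomputable def y₂ : CPhi α β γ δ :=
  y α β γ δ + y₁ α β γ δ

/-- `w = β y₂ + γ x + y₁ ^ 2`. -/
noncomputable def w : CPhi α β γ δ :=
  β • y₂ α β γ δ + γ • x α β γ δ + y₁ α β γ δ ^ 2

/-- `Δ = -γ ^ 3 α + γ ^ 2 β ^ 2 - β ^ 3 δ + β ^ 6`. -/
def Δ : F := -γ ^ 3 * α + γ ^ 2 * β ^ 2 - β ^ 3 * δ + β ^ 6

end CPhi

/-- The (possibly singular) affine plane cubic `E_D : s ^ 2 = r ^ 3 + D`. -/
def cubicCurve {F : Type*} [Field F] (D : F) : WeierstrassCurve.Affine F :=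
  ⟨0, 0, 0, 0, D⟩

/-- The points of `E_D : s ^ 2 = r ^ 3 + D` with coordinates in the algebraic closure of `F`. -/
@[ext]
structure CubicPoint {F : Type*} [Field F] (D : F) where
  r : AlgebraicClosure F
  s : AlgebraicClosure F
  eq : s ^ 2 = r ^ 3 + algebraMap F (AlgebraicClosure F) D

namespace CubicPoint

variable {F : Type*} [Field F] {D : F}

/-- The automorphisms of the algebraic closure over `F` act coordinatewise on the points. -/
noncomputable instance :
    MulAction (AlgebraicClosure F ≃ₐ[F] AlgebraicClosure F) (CubicPoint D) where
  smul σ P := ⟨σ P.r, σ P.s, by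
    rw [← map_pow, P.eq, map_add, map_pow, AlgEquiv.commutes]⟩
  one_smul _ := rfl
  mul_smul _ _ _ := rfl

/-- The field `F[r₀, s₀]` generated by the coordinates of the point `(r₀, s₀)`. -/
noncomputable abbrev field (P : CubicPoint D) : IntermediateField F (AlgebraicClosure F) :=
  IntermediateField.adjoin F {P.r, P.s}

/-- `r₀` as an element of `F[r₀, s₀]`. -/
noncomputable def r₀ (P : CubicPoint D) : P.field :=
  ⟨P.r, IntermediateField.subset_adjoin F _ (by simp)⟩

/-- `s₀` as an element of `F[r₀, s₀]`. -/
noncomputable def s₀ (P : CubicPoint D) : P.field :=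
  ⟨P.s, IntermediateField.subset_adjoin F _ (by simp)⟩

end CubicPoint

/-- The Galois orbits of points of `E_D` over the algebraic closure of `F`. -/
abbrev CubicOrbit {F : Type*} [Field F] (D : F) : Type _ :=
  MulAction.orbitRel.Quotient (AlgebraicClosure F ≃ₐ[F] AlgebraicClosure F) (CubicPoint D)

/-- Defining relations of `[a, b)_{p, R}`, with generators `x, y` indexed by `0, 1`:
`x ^ p - x = a`, `y ^ p = b` and `y x - x y = y`. -/
inductive SymbolRel (p : ℕ) (R : Type*) [CommRing R] (a b : R) :
    FreeAlgebra R (Fin 2) → FreeAlgebra R (Fin 2) → Prop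
  | artinSchreier : SymbolRel p R a b
      (FreeAlgebra.ι R 0 ^ p - FreeAlgebra.ι R 0) (algebraMap R (FreeAlgebra R (Fin 2)) a)
  | central : SymbolRel p R a b
      (FreeAlgebra.ι R 1 ^ p) (algebraMap R (FreeAlgebra R (Fin 2)) b)
  | commutator : SymbolRel p R a b
      (FreeAlgebra.ι R 1 * FreeAlgebra.ι R 0 - FreeAlgebra.ι R 0 * FreeAlgebra.ι R 1)
      (FreeAlgebra.ι R 1)

/-- The symbol algebra
`[a, b)_{p, R} = R⟨x, y : x ^ p - x = a, y ^ p = b, y x - x y = y⟩`. Over a field `R` of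
characteristic `p` and for `b ≠ 0`, these are the cyclic algebras of degree `p` over `R`. -/
abbrev SymbolAlg (p : ℕ) (R : Type*) [CommRing R] (a b : R) : Type _ :=
  RingQuot (SymbolRel p R a b)

/-- The simple homomorphic images of a ring `A`, each recorded by its kernel: the two-sided ideals
of `A` whose quotient is a simple ring. -/
abbrev SimpleImage (A : Type*) [Ring A] : Type _ :=
  {I : TwoSidedIdeal A // IsSimpleRing I.ringCon.Quotient}

/-- The cyclic algebra `[α β⁻³ (s₀ + β ^ 3), α)_{3, F[r₀, s₀]}` attached to the point
`(r₀, s₀)`. -/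
abbrev pointAlg {F : Type*} [Field F] {D : F} (α β : F) (P : CubicPoint D) : Type _ :=
  SymbolAlg 3 P.field
    (algebraMap F P.field (α * (β ^ 3)⁻¹) * (P.s₀ + algebraMap F P.field (β ^ 3)))
    (algebraMap F P.field α)

/-!
Over the subalgebra `R = F[w, y₁ ^ 3]` of its center, the algebra `C_Φ` is generated by
`u = β⁻¹ y₁ x` and `v = x`, and these satisfy `u ^ 3 - u = α β⁻³ y₁ ^ 3`, `v ^ 3 = α` and
`v u - u v = v`. Conversely, a pair `u, v` with these relations over the coordinate ring of `E_Δ`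
yields back `x` and `y` satisfying the relations of `C_Φ`, so `C_Φ` is the symbol algebra
`[α β⁻³ (s + β ^ 3), α)` over that coordinate ring.

In a symbol algebra, the coordinates of an element with respect to the monomials `u ^ i v ^ j` are
computed by sandwich operators `t ↦ ∑ₖ aₖ t bₖ`: the commutator with `u` is diagonalized by the
monomials, with eigenvalues `0, …, p - 1`, and summing over the conjugates by powers of `v`
extracts the coefficients of the powers of `u`. A free module basis with this property makes the
algebra Azumaya, with center the base ring, and makes every two-sided ideal extended from the base.
The simple images of `C_Φ` therefore correspond to the maximal ideals of the coordinate ring, that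
is, to the Galois orbits of its points.
-/

open scoped TensorProduct

/-! ### Sandwich operators -/

section SandwichOperators

variable {R A ι : Type*} [CommRing R] [Ring A] [Algebra R A]

lemma mulLeft_mem_range_mulLeftRight (a : A) :
    LinearMap.mulLeft R a ∈ (AlgHom.mulLeftRight R A).range :=
  ⟨a ⊗ₜ 1, by ext; simp⟩

lemma mulRight_mem_range_mulLeftRight (a : A) :
    LinearMap.mulRight R a ∈ (AlgHom.mulLeftRight R A).range :=
  ⟨1 ⊗ₜ MulOpposite.op a, by ext; simp⟩

lemma exists_mem_range_mulLeftRight_of_algebra (S : Type*) [CommRing S] [Algebra S A]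
    {φ : Module.End R A} (hφ : φ ∈ (AlgHom.mulLeftRight R A).range) :
    ∃ ψ ∈ (AlgHom.mulLeftRight S A).range, ∀ x, ψ x = φ x := by
  obtain ⟨t, rfl⟩ := hφ
  induction t using TensorProduct.induction_on with
  | zero => exact ⟨0, zero_mem _, by simp⟩
  | tmul a b => exact ⟨_, ⟨a ⊗ₜ[S] b, rfl⟩, by simp⟩
  | add s t hs ht =>
    obtain ⟨ψ, hψ, hψs⟩ := hs
    obtain ⟨χ, hχ, hχt⟩ := ht
    exact ⟨ψ + χ, add_mem hψ hχ, by simp [hψs, hχt]⟩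

lemma apply_mem_twoSidedIdeal_of_mem_range_mulLeftRight (I : TwoSidedIdeal A)
    {φ : Module.End R A} (hφ : φ ∈ (AlgHom.mulLeftRight R A).range) {x : A} (hx : x ∈ I) :
    φ x ∈ I := by
  obtain ⟨t, rfl⟩ := hφ
  induction t using TensorProduct.induction_on with
  | zero => simp
  | tmul a b => simpa using I.mul_mem_right _ _ (I.mul_mem_left _ _ hx)
  | add s t hs ht => simpa using I.add_mem hs ht

lemma apply_eq_mul_apply_one_of_mem_range_mulLeftRight {φ : Module.End R A}
    (hφ : φ ∈ (AlgHom.mulLeftRight R A).range) {z : A} (hz : z ∈ Subring.center A) :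
    φ z = z * φ 1 := by
  rw [Subring.mem_center_iff] at hz
  obtain ⟨t, rfl⟩ := hφ
  induction t using TensorProduct.induction_on with
  | zero => simp
  | tmul a b => simp [hz a, mul_assoc]
  | add s t hs ht => simp_all [mul_add]

/-- A spanning family of an `R`-algebra whose coordinate functions, with values in `R · 1`, are
sandwich operators, that is, sums of operators `x ↦ a * x * b`. It is a basis as soon as `R` embeds
into the algebra. -/
structure IsSandwichBasis (R : Type*) {A ι : Type*} [CommRing R] [Ring A] [Algebra R A]
    [DecidableEq ι] (e : ι → A) : Prop where
  span_eq_top : Submodule.span R (Set.range e) = ⊤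
  exists_dual : ∀ i, ∃ E ∈ (AlgHom.mulLeftRight R A).range, ∀ j, E (e j) = if i = j then 1 else 0

namespace IsSandwichBasis

variable [DecidableEq ι] {e : ι → A}

lemma of_range_algebraMap_le {S : Type*} [CommRing S] [Algebra S A] (h : IsSandwichBasis R e)
    (hRS : (algebraMap R A).range ≤ (algebraMap S A).range) : IsSandwichBasis S e where
  span_eq_top := by
    let N : Submodule R A :=
      { Submodule.span S (Set.range e) with
        smul_mem' := fun r x hx ↦ by
          obtain ⟨s, hs⟩ := hRS ⟨r, rfl⟩
          rw [Algebra.smul_def, ← hs, ← Algebra.smul_def]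
          exact Submodule.smul_mem _ s hx }
    have hN : N = ⊤ := top_le_iff.1 (h.span_eq_top.ge.trans (Submodule.span_le.2 fun _ hx ↦
      Submodule.subset_span (R := S) hx))
    exact eq_top_iff.2 fun x _ ↦ show x ∈ N from hN ▸ Submodule.mem_top
  exists_dual i := by
    obtain ⟨E, hE, hEe⟩ := h.exists_dual i
    obtain ⟨E', hE', hEE'⟩ := exists_mem_range_mulLeftRight_of_algebra S hE
    exact ⟨E', hE', fun j ↦ by rw [hEE', hEe]⟩

lemma exists_coord (h : IsSandwichBasis R e) (i : ι) :
    ∃ E ∈ (AlgHom.mulLeftRight R A).range, (∀ j, E (e j) = if i = j then 1 else 0) ∧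
      ∀ a, E a ∈ (algebraMap R A).range := by
  obtain ⟨E, hE, hEe⟩ := h.exists_dual i
  refine ⟨E, hE, hEe, fun a ↦ ?_⟩
  have hspan : Submodule.span R (Set.range e) ≤ (1 : Submodule R A).comap E := by
    rw [Submodule.span_le, Set.range_subset_iff]
    intro j
    by_cases hij : i = j <;> simp [hEe, hij, Submodule.one_le.1 le_rfl]
  obtain ⟨r, hr⟩ := Submodule.mem_one.1 (hspan (h.span_eq_top.ge (Submodule.mem_top (x := a))))
  exact ⟨r, hr⟩

lemma linearIndependent (h : IsSandwichBasis R e) [FaithfulSMul R A] : LinearIndependent R e := by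
  rw [linearIndependent_iff']
  intro s g hg i hi
  obtain ⟨E, -, hE⟩ := h.exists_dual i
  apply FaithfulSMul.algebraMap_injective R A
  simpa [hE, hi, Algebra.algebraMap_eq_smul_one] using congrArg E hg

/-- A sandwich basis as a `Module.Basis`, when `R` embeds into the algebra. -/
noncomputable def basis (h : IsSandwichBasis R e) [FaithfulSMul R A] : Module.Basis ι R A :=
  .mk h.linearIndependent h.span_eq_top.ge

lemma surjective_mulLeftRight [Finite ι] (h : IsSandwichBasis R e) :
    Function.Surjective (AlgHom.mulLeftRight R A) := by
  have := Fintype.ofFinite ι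
  intro φ
  choose E hE hEe using h.exists_dual
  have hφ : φ = ∑ i, LinearMap.mulLeft R (φ (e i)) * E i :=
    LinearMap.ext_on_range h.span_eq_top fun j ↦ by simp [hEe]
  rw [← AlgHom.mem_range, hφ]
  exact sum_mem fun i _ ↦ mul_mem (mulLeft_mem_range_mulLeftRight _) (hE i)

lemma isAzumaya [Finite ι] (h : IsSandwichBasis R e) [FaithfulSMul R A] : IsAzumaya R A := by
  have := Fintype.ofFinite ι
  have : Module.Free R A := .of_basis h.basis
  have : Module.Finite R A := .of_basis h.basis
  -- Both sides are free of rank `(card ι) ^ 2`, so the surjection is bijective.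
  let eqv : Module.End R A ≃ₗ[R] A ⊗[R] Aᵐᵒᵖ :=
    (LinearMap.toMatrix h.basis h.basis).trans <| (Matrix.stdBasis R ι ι).equiv
      (h.basis.tensorProduct (h.basis.map (MulOpposite.opLinearEquiv R))) (.refl _)
  have hinj : Function.Injective (eqv.toLinearMap ∘ₗ (AlgHom.mulLeftRight R A).toLinearMap) :=
    OrzechProperty.injective_of_surjective_endomorphism _
      (eqv.surjective.comp h.surjective_mulLeftRight)
  exact { bij := ⟨Function.Injective.of_comp (f := eqv) hinj, h.surjective_mulLeftRight⟩ }

lemma finrank_eq [Nontrivial R] (h : IsSandwichBasis R e) [FaithfulSMul R A] :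
    Module.finrank R A = Nat.card ι :=
  Module.finrank_eq_nat_card_basis h.basis

lemma rankAtStalk_eq [Finite ι] (h : IsSandwichBasis R e) [FaithfulSMul R A]
    (p : PrimeSpectrum R) : Module.rankAtStalk A p = Nat.card ι := by
  have : Nontrivial R := p.nontrivial
  have : Module.Free R A := .of_basis h.basis
  have : Module.Finite R A := .of_basis h.basis
  simp [Module.rankAtStalk_eq_finrank_of_free, h.finrank_eq]

lemma twoSidedIdeal_le [Finite ι] (h : IsSandwichBasis R e) {I J : TwoSidedIdeal A}
    (hIJ : ∀ r : R, algebraMap R A r ∈ I → algebraMap R A r ∈ J) : I ≤ J := by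
  have := Fintype.ofFinite ι
  intro a ha
  choose E hE hEe hEa using h.exists_coord
  have hsum : LinearMap.id = ∑ i, LinearMap.mulRight R (e i) * E i :=
    LinearMap.ext_on_range h.span_eq_top fun j ↦ by simp [hEe]
  rw [← LinearMap.id_apply (R := R) a, hsum, LinearMap.sum_apply]
  refine sum_mem fun i _ ↦ J.mul_mem_right _ _ ?_
  obtain ⟨r, hr⟩ := hEa i a
  exact hr ▸ hIJ r (hr ▸ apply_mem_twoSidedIdeal_of_mem_range_mulLeftRight I (hE i) ha)

lemma center_eq_range_algebraMap (h : IsSandwichBasis R e) {i : ι} (hi : e i = 1) :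
    Subring.center A = (algebraMap R A).range := by
  refine le_antisymm (fun z hz ↦ ?_) ?_
  · obtain ⟨E, hE, hEe, hEa⟩ := h.exists_coord i
    have hE1 : E 1 = 1 := by simpa [hi] using hEe i
    simpa [apply_eq_mul_apply_one_of_mem_range_mulLeftRight hE hz, hE1] using hEa z
  · rintro _ ⟨r, rfl⟩
    exact Subring.mem_center_iff.2 fun a ↦ (Algebra.commutes r a).symm

end IsSandwichBasis

lemma IsSandwichBasis.isSimpleRing {K : Type*} [Field K] [Algebra K A] [Nontrivial A]
    [DecidableEq ι] [Finite ι] {e : ι → A} (h : IsSandwichBasis K e) : IsSimpleRing A := by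
  refine .of_eq_bot_or_eq_top fun I ↦ or_iff_not_imp_right.2 fun hI ↦ ?_
  refine le_bot_iff.1 (h.twoSidedIdeal_le fun r hr ↦ ?_)
  suffices r = 0 by simp [this]
  by_contra hr0
  refine hI (I.eq_top ?_)
  simpa [← map_mul, inv_mul_cancel₀ hr0] using I.mul_mem_left (algebraMap K A r⁻¹) _ hr

end SandwichOperators

/-! ### Symbol pairs -/

section PrimeField

variable {p : ℕ} [Fact p.Prime] {R : Type*} [CommRing R] [CharP R p]

lemma natCast_sub_natCast_pow_pred {i j : ℕ} (hi : i < p) (hj : j < p) :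
    ((i : R) - j) ^ (p - 1) = if i = j then 0 else 1 := by
  split_ifs with hij
  · simp [hij, Nat.sub_ne_zero_of_lt (Fact.out : p.Prime).one_lt]
  · have hne : (i : ZMod p) - j ≠ 0 := by
      rw [sub_ne_zero, Ne, ZMod.natCast_eq_natCast_iff]
      exact fun h ↦ hij (h.eq_of_lt_of_lt hi hj)
    simpa using congrArg (ZMod.castHom dvd_rfl R) (ZMod.pow_card_sub_one_eq_one hne)

lemma sum_range_natCast_pow {m : ℕ} (hm : m < p) :
    ∑ i ∈ Finset.range p, (i : R) ^ m = if m = p - 1 then -1 else 0 := by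
  split_ifs with hmp
  · have hp := (Fact.out : p.Prime).pos
    have hi (i : ℕ) (hi : i ∈ Finset.range p) : (i : R) ^ m = if i = 0 then 0 else 1 := by
      simpa [hmp] using natCast_sub_natCast_pow_pred (R := R) (Finset.mem_range.1 hi) hp
    rw [Finset.sum_congr rfl hi, Finset.sum_ite, Finset.sum_const_zero, zero_add, Finset.sum_const,
      Finset.filter_ne', Finset.card_erase_of_mem (Finset.mem_range.2 hp), Finset.card_range,
      nsmul_one, Nat.cast_sub hp, CharP.cast_eq_zero, Nat.cast_one, zero_sub]
  · have hsum : ∑ i : ZMod p, i ^ m = 0 :=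
      FiniteField.sum_pow_lt_card_sub_one _ m (by rw [ZMod.card]; omega)
    rw [← map_zero (ZMod.castHom dvd_rfl R), ← hsum, map_sum]
    refine Finset.sum_nbij' (fun i ↦ (i : ZMod p)) ZMod.val ?_ ?_ ?_ ?_ ?_ <;>
      simp +contextual [ZMod.val_lt, Nat.mod_eq_of_lt]

lemma sum_range_add_natCast_pow {A : Type*} [Ring A] [Algebra R A] (x : A) {m : ℕ} (hm : m < p) :
    ∑ i ∈ Finset.range p, (x + i) ^ m = if m = p - 1 then -1 else 0 := by
  have hpow (k : ℕ) (hk : k < p) :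
      ∑ i ∈ Finset.range p, (i : A) ^ k = if k = p - 1 then -1 else 0 := by
    simpa [apply_ite] using congrArg (algebraMap R A) (sum_range_natCast_pow (R := R) hk)
  simp_rw [((Nat.cast_commute _ x).symm).add_pow]
  rw [Finset.sum_comm, Finset.sum_eq_single_of_mem 0 (by simp)]
  · simp [hpow m hm]
  · intro k hk hk0
    rw [← Finset.sum_mul, ← Finset.mul_sum, hpow _ (by omega), if_neg (by grind), mul_zero,
      zero_mul]

end PrimeField

section Generation

variable {R A : Type*} [CommRing R] [Ring A] [Algebra R A]

lemma eq_top_of_one_mem_of_mul_mem {s : Set A} (hs : Algebra.adjoin R s = ⊤) {N : Submodule R A}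
    (h1 : 1 ∈ N) (hN : ∀ x ∈ s, ∀ y ∈ N, x * y ∈ N) : N = ⊤ := by
  refine Submodule.eq_top_iff'.2 fun x ↦ ?_
  suffices ∀ y ∈ N, x * y ∈ N by simpa using this 1 h1
  have hx : x ∈ Algebra.adjoin R s := hs ▸ Algebra.mem_top
  induction hx using Algebra.adjoin_induction with
  | mem x hx => exact hN x hx
  | algebraMap r => exact fun y hy ↦ by simpa [Algebra.smul_def] using N.smul_mem r hy
  | add x₁ x₂ _ _ h₁ h₂ => exact fun y hy ↦ by simpa [add_mul] using N.add_mem (h₁ y hy) (h₂ y hy)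
  | mul x₁ x₂ _ _ h₁ h₂ => exact fun y hy ↦ by simpa [mul_assoc] using h₁ _ (h₂ y hy)

lemma span_range_pow_eq_adjoin {x : A} {f : Polynomial R} {n : ℕ} (hf : f.Monic)
    (hn : f.natDegree = n) (hx : Polynomial.aeval x f = 0) :
    Submodule.span R (Set.range fun i : Fin n ↦ x ^ (i : ℕ)) =
      Subalgebra.toSubmodule (Algebra.adjoin R {x}) := by
  rw [← Submodule.span_range_natDegree_eq_adjoin hf hx, hn]
  congr 1
  ext y
  simp [Fin.exists_iff]

lemma monic_artinSchreier {p : ℕ} (hp : 1 < p) (a : R) :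
    (.X ^ p - .X - .C a : Polynomial R).Monic := by
  rw [sub_sub]
  refine Polynomial.monic_X_pow_sub ?_
  nontriviality R
  rw [Polynomial.degree_X_add_C]
  exact_mod_cast hp

lemma natDegree_artinSchreier [Nontrivial R] {p : ℕ} (hp : 1 < p) (a : R) :
    (.X ^ p - .X - .C a : Polynomial R).natDegree = p := by
  rw [sub_sub, Polynomial.natDegree_sub_eq_left_of_natDegree_lt, Polynomial.natDegree_X_pow]
  simpa using hp

end Generation

/-- A pair `u, v` satisfying the relations `u ^ p - u = a`, `v ^ p = b`, `v * u - u * v = v` of the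
symbol algebra `[a, b)_{p, R}`. -/
structure IsSymbolPair (p : ℕ) {R A : Type*} [CommRing R] [Ring A] [Algebra R A] (a b : R)
    (u v : A) : Prop where
  artinSchreier : u ^ p - u = algebraMap R A a
  pow_eq : v ^ p = algebraMap R A b
  commutator : v * u - u * v = v

/-- The monomials `u ^ i * v ^ j` with `i, j < p`. -/
def symbolMonomial {A : Type*} [Monoid A] (p : ℕ) (u v : A) (ij : Fin p × Fin p) : A :=
  u ^ (ij.1 : ℕ) * v ^ (ij.2 : ℕ)

namespace IsSymbolPair

variable {p : ℕ} {R A : Type*} [CommRing R] [Ring A] [Algebra R A] {a b : R} {u v : A}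

lemma semiconjBy (h : IsSymbolPair p a b u v) : SemiconjBy v u (u + 1) := by
  rw [SemiconjBy, add_mul, one_mul, add_comm]
  exact sub_eq_iff_eq_add.1 h.commutator

lemma semiconjBy_add_natCast (h : IsSymbolPair p a b u v) (i j : ℕ) :
    SemiconjBy (v ^ j) (u + i) (u + (i + j : ℕ)) := by
  induction j with
  | zero => simp
  | succ j ih =>
    have hv : SemiconjBy v (u + (i + j : ℕ)) (u + 1 + (i + j : ℕ)) :=
      h.semiconjBy.add_right (Nat.cast_commute _ v).symm
    rw [pow_succ', Nat.add_succ, Nat.cast_succ, ← add_assoc, add_right_comm]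
    exact hv.mul_left ih

lemma isUnit (h : IsSymbolPair p a b u v) (hp : p ≠ 0) (hb : IsUnit b) : IsUnit v :=
  (isUnit_pow_iff hp).1 (h.pow_eq ▸ hb.map (algebraMap R A))

lemma pow_eq_add (h : IsSymbolPair p a b u v) : u ^ p = u + algebraMap R A a := by
  rw [← h.artinSchreier, add_sub_cancel]

section Span

lemma exists_mul_eq_of_mem_adjoin (h : IsSymbolPair p a b u v) {x : A}
    (hx : x ∈ Algebra.adjoin R {u}) : ∃ y ∈ Algebra.adjoin R {u}, v * x = y * v := by
  induction hx using Algebra.adjoin_induction with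
  | mem x hx =>
    obtain rfl := hx
    exact ⟨x + 1, add_mem (Algebra.self_mem_adjoin_singleton R x) (one_mem _), h.semiconjBy⟩
  | algebraMap r => exact ⟨_, algebraMap_mem _ r, (Algebra.commutes r v).symm⟩
  | add x₁ x₂ _ _ h₁ h₂ =>
    obtain ⟨y₁, hy₁, h₁⟩ := h₁
    obtain ⟨y₂, hy₂, h₂⟩ := h₂
    exact ⟨y₁ + y₂, add_mem hy₁ hy₂, by rw [mul_add, h₁, h₂, add_mul]⟩
  | mul x₁ x₂ _ _ h₁ h₂ =>
    obtain ⟨y₁, hy₁, h₁⟩ := h₁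
    obtain ⟨y₂, hy₂, h₂⟩ := h₂
    exact ⟨y₁ * y₂, mul_mem hy₁ hy₂, by rw [← mul_assoc, h₁, mul_assoc, h₂, mul_assoc]⟩

lemma adjoin_mul_adjoin_eq_top (h : IsSymbolPair p a b u v)
    (huv : Algebra.adjoin R {u, v} = ⊤) :
    Subalgebra.toSubmodule (Algebra.adjoin R {u}) *
      Subalgebra.toSubmodule (Algebra.adjoin R {v}) = ⊤ := by
  have mem_mul {s t : A} (hs : s ∈ Algebra.adjoin R {u}) (ht : t ∈ Algebra.adjoin R {v}) :
      s * t ∈ Subalgebra.toSubmodule (Algebra.adjoin R {u}) *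
        Subalgebra.toSubmodule (Algebra.adjoin R {v}) :=
    Submodule.mul_mem_mul hs ht
  refine eq_top_of_one_mem_of_mul_mem huv (by simpa using mem_mul (one_mem _) (one_mem _))
    fun x hx y hy ↦ ?_
  induction hy using Submodule.mul_induction_on' with
  | mem_mul_mem s hs t ht =>
    obtain rfl | rfl := hx
    · rw [← mul_assoc]
      exact mem_mul (mul_mem (Algebra.self_mem_adjoin_singleton R x) hs) ht
    · obtain ⟨s', hs', hvs⟩ := h.exists_mul_eq_of_mem_adjoin hs
      rw [← mul_assoc, hvs, mul_assoc]
      exact mem_mul hs' (mul_mem (Algebra.self_mem_adjoin_singleton R x) ht)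
  | add y₁ _ y₂ _ h₁ h₂ => simpa [mul_add] using add_mem h₁ h₂

lemma span_symbolMonomial_eq_top [Nontrivial R] (hp : 1 < p) (h : IsSymbolPair p a b u v)
    (huv : Algebra.adjoin R {u, v} = ⊤) :
    Submodule.span R (Set.range (symbolMonomial p u v)) = ⊤ := by
  rw [← h.adjoin_mul_adjoin_eq_top huv,
    ← span_range_pow_eq_adjoin (monic_artinSchreier hp a) (natDegree_artinSchreier hp a)
      (by simp [← h.artinSchreier]),
    ← span_range_pow_eq_adjoin (Polynomial.monic_X_pow_sub_C b (zero_lt_one.trans hp).ne')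
      Polynomial.natDegree_X_pow_sub_C (by simp [h.pow_eq]), Submodule.span_mul_span]
  congr 1
  ext y
  simp only [Set.mem_range, Set.mem_mul, Prod.exists, symbolMonomial, exists_exists_eq_and]

end Span

section Dual

variable [Fact p.Prime] [CharP R p]

lemma exists_projection (h : IsSymbolPair p a b u v) {j : ℕ} (hj : j < p) :
    ∃ P ∈ (AlgHom.mulLeftRight R A).range,
      ∀ k l, l < p → P (u ^ k * v ^ l) = if j = l then u ^ k * v ^ l else 0 := by
  -- `u ^ k * v ^ l` is an eigenvector of `D` with eigenvalue `l - j`, so Fermat's little theorem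
  -- makes `1 - D ^ (p - 1)` the projection.
  let D : Module.End R A :=
    LinearMap.mulRight R u - LinearMap.mulLeft R u - (j : R) • 1
  refine ⟨1 - D ^ (p - 1), sub_mem (one_mem _) (pow_mem (sub_mem (sub_mem
    (mulRight_mem_range_mulLeftRight u) (mulLeft_mem_range_mulLeftRight u))
    (Subalgebra.smul_mem _ (one_mem _) _)) _), fun k l hl ↦ ?_⟩
  have hD : D (u ^ k * v ^ l) = ((l : R) - j) • (u ^ k * v ^ l) := by
    have hvu : v ^ l * u = (u + l) * v ^ l := by simpa using (h.semiconjBy_add_natCast 0 l).eq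
    calc D (u ^ k * v ^ l)
        = u ^ k * (v ^ l * u) - u * u ^ k * v ^ l - (j : R) • (u ^ k * v ^ l) := by
          simp only [D, LinearMap.sub_apply, LinearMap.smul_apply, LinearMap.mulRight_apply,
            LinearMap.mulLeft_apply, Module.End.one_apply, mul_assoc]
      _ = (l : A) * (u ^ k * v ^ l) - (j : R) • (u ^ k * v ^ l) := by
          rw [hvu, ← mul_assoc, mul_add, ← pow_succ, ← pow_succ', add_mul, add_sub_cancel_left,
            ← Nat.cast_comm, mul_assoc]
      _ = ((l : R) - j) • (u ^ k * v ^ l) := by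
          rw [sub_smul, Nat.cast_smul_eq_nsmul R l, nsmul_eq_mul]
  have hDn (n : ℕ) : (D ^ n) (u ^ k * v ^ l) = ((l : R) - j) ^ n • (u ^ k * v ^ l) := by
    induction n with
    | zero => simp
    | succ n ih => rw [pow_succ', Module.End.mul_apply, ih, map_smul, hD, smul_smul, pow_succ]
  rw [LinearMap.sub_apply, hDn, natCast_sub_natCast_pow_pred hl hj]
  by_cases hlj : l = j
  · simp [hlj]
  · simp [hlj, Ne.symm hlj]

lemma exists_trace (h : IsSymbolPair p a b u v) (hb : IsUnit b) :
    ∃ τ ∈ (AlgHom.mulLeftRight R A).range,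
      ∀ n ≤ 2 * (p - 1), τ (u ^ n) = if n = p - 1 ∨ n = 2 * (p - 1) then 1 else 0 := by
  have hp := (Fact.out : p.Prime).one_lt
  obtain ⟨v, rfl⟩ := h.isUnit (by omega) hb
  let τ : Module.End R A := -∑ i ∈ Finset.range p,
    LinearMap.mulLeft R ((v : A) ^ i) * LinearMap.mulRight R ((↑v⁻¹ : A) ^ i)
  refine ⟨τ, neg_mem (sum_mem fun i _ ↦ mul_mem (mulLeft_mem_range_mulLeftRight _)
    (mulRight_mem_range_mulLeftRight _)), fun n hn ↦ ?_⟩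
  have hτ (k : ℕ) (hk : k < p) : τ (u ^ k) = if k = p - 1 then 1 else 0 := by
    have hconj (i : ℕ) : (v : A) ^ i * (u ^ k * (↑v⁻¹ : A) ^ i) = (u + i) ^ k := by
      have hvu : SemiconjBy ((v : A) ^ i) (u ^ k) ((u + i) ^ k) := by
        simpa using (h.semiconjBy_add_natCast 0 i).pow_right k
      rw [← mul_assoc, hvu.eq, mul_assoc, ← Units.val_pow_eq_pow_val, ← Units.val_pow_eq_pow_val,
        inv_pow, Units.mul_inv, mul_one]
    simp only [τ, LinearMap.neg_apply, LinearMap.sum_apply, Module.End.mul_apply,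
      LinearMap.mulLeft_apply, LinearMap.mulRight_apply, hconj,
      sum_range_add_natCast_pow (R := R) u hk]
    split_ifs <;> simp
  obtain hnp | hpn := lt_or_ge n p
  · rw [hτ n hnp]
    grind
  · obtain ⟨m, rfl⟩ := Nat.exists_eq_add_of_le hpn
    rw [pow_add, h.pow_eq_add, add_mul, ← pow_succ', ← Algebra.smul_def, map_add, map_smul,
      hτ _ (by omega), hτ _ (by omega),
      if_neg (by omega : m ≠ p - 1), smul_zero, add_zero]
    grind

lemma exists_dual_pow (h : IsSymbolPair p a b u v) (hb : IsUnit b) {i : ℕ} (hi : i < p) :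
    ∃ E ∈ (AlgHom.mulLeftRight R A).range, ∀ k < p, E (u ^ k) = if i = k then 1 else 0 := by
  have hp := (Fact.out : p.Prime).one_lt
  obtain ⟨τ, hτ, hτu⟩ := h.exists_trace hb
  obtain rfl | hi0 := eq_or_ne i 0
  · refine ⟨τ * LinearMap.mulLeft R (u ^ (p - 1)) - τ, sub_mem (mul_mem hτ
      (mulLeft_mem_range_mulLeftRight _)) hτ, fun k hk ↦ ?_⟩
    rw [LinearMap.sub_apply, Module.End.mul_apply, LinearMap.mulLeft_apply, ← pow_add,
      hτu _ (by omega), hτu _ (by omega)]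
    grind
  · refine ⟨τ * LinearMap.mulLeft R (u ^ (p - 1 - i)), mul_mem hτ
      (mulLeft_mem_range_mulLeftRight _), fun k hk ↦ ?_⟩
    rw [Module.End.mul_apply, LinearMap.mulLeft_apply, ← pow_add, hτu _ (by omega)]
    congr 1
    grind

theorem isSandwichBasis (h : IsSymbolPair p a b u v) (hb : IsUnit b)
    (huv : Algebra.adjoin R {u, v} = ⊤) : IsSandwichBasis R (symbolMonomial p u v) where
  span_eq_top :=
    have := CharP.nontrivial_of_char_ne_one (R := R) (Fact.out : p.Prime).ne_one
    h.span_symbolMonomial_eq_top (Fact.out : p.Prime).one_lt huv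
  exists_dual := by
    rintro ⟨i, j⟩
    obtain ⟨P, hP, hPe⟩ := h.exists_projection j.2
    obtain ⟨E, hE, hEu⟩ := h.exists_dual_pow hb i.2
    obtain ⟨v, rfl⟩ := h.isUnit (Fact.out : p.Prime).ne_zero hb
    refine ⟨E * LinearMap.mulRight R ((↑v⁻¹ : A) ^ (j : ℕ)) * P, mul_mem (mul_mem hE
      (mulRight_mem_range_mulLeftRight _)) hP, fun ⟨k, l⟩ ↦ ?_⟩
    have hPkl := hPe k l l.2
    by_cases hjl : j = l
    · subst hjl
      have hv : (v : A) ^ (j : ℕ) * (↑v⁻¹ : A) ^ (j : ℕ) = 1 := by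
        rw [← Units.val_pow_eq_pow_val, ← Units.val_pow_eq_pow_val, inv_pow, Units.mul_inv]
      simp [symbolMonomial, hPkl, mul_assoc, hv, hEu, Fin.ext_iff]
    · simp [symbolMonomial, hPkl, hjl, Fin.val_inj]

end Dual

end IsSymbolPair

lemma isSymbolPair_algebraMap_iff {p : ℕ} {R S A : Type*} [CommRing R] [CommRing S] [Ring A]
    [Algebra R S] [Algebra S A] [Algebra R A] [IsScalarTower R S A] {a b : R} {u v : A} :
    IsSymbolPair p (algebraMap R S a) (algebraMap R S b) u v ↔ IsSymbolPair p a b u v := by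
  constructor <;> rintro ⟨ha, hb, huv⟩
  · exact ⟨by rw [ha, ← IsScalarTower.algebraMap_apply],
      by rw [hb, ← IsScalarTower.algebraMap_apply], huv⟩
  · exact ⟨by rw [ha, IsScalarTower.algebraMap_apply R S A],
      by rw [hb, IsScalarTower.algebraMap_apply R S A], huv⟩

section ShiftRepresentation

universe t

open Polynomial in
lemma exists_faithfulSMul_aeval_eq_zero {R : Type t} [CommRing R] {f : R[X]}
    (hf : f.Monic) (hdeg : f.natDegree ≠ 0) :
    ∃ (S : Type t) (_ : CommRing S) (_ : Algebra R S) (_ : FaithfulSMul R S) (x : S),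
      aeval x f = 0 := by
  have : Nontrivial (AdjoinRoot f) := Ideal.Quotient.nontrivial_iff.2 <| by
    rw [Ne, Ideal.span_singleton_eq_top, hf.isUnit_iff]
    rintro rfl
    exact hdeg natDegree_one
  have := hf.free_adjoinRoot
  exact ⟨AdjoinRoot f, inferInstance, inferInstance, inferInstance, AdjoinRoot.root f, by simp⟩

variable {p : ℕ} [Fact p.Prime]

lemma exists_faithfulSMul_roots_symbol {R : Type t} [CommRing R] [Nontrivial R] (a b : R) :
    ∃ (S : Type t) (_ : CommRing S) (_ : Algebra R S) (_ : FaithfulSMul R S) (θ η : S),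
      θ ^ p - θ = algebraMap R S a ∧ η ^ p = algebraMap R S b := by
  have hp := (Fact.out : p.Prime).one_lt
  obtain ⟨S, _, _, _, θ, hθ⟩ := exists_faithfulSMul_aeval_eq_zero (monic_artinSchreier hp a)
    (by rw [natDegree_artinSchreier hp]; omega)
  have := (FaithfulSMul.algebraMap_injective R S).nontrivial
  obtain ⟨T, _, _, _, η, hη⟩ := exists_faithfulSMul_aeval_eq_zero
    (Polynomial.monic_X_pow_sub_C (algebraMap R S b) (by omega : p ≠ 0))
    (by rw [Polynomial.natDegree_X_pow_sub_C]; omega)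
  let _ : Algebra R T := ((algebraMap S T).comp (algebraMap R S)).toAlgebra
  have : IsScalarTower R S T := .of_algebraMap_eq fun _ ↦ rfl
  refine ⟨T, inferInstance, inferInstance, .trans R S T, algebraMap S T θ, η, ?_, ?_⟩
  · rw [IsScalarTower.algebraMap_apply R S T, ← map_pow, ← map_sub]
    exact congrArg _ (sub_eq_zero.1 (by simpa using hθ))
  · exact sub_eq_zero.1 (by simpa [IsScalarTower.algebraMap_apply R S T] using hη)

lemma isSymbolPair_mulLeft_smul_funLeft {S : Type*} [CommRing S] [CharP S p] (θ η : S) :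
    IsSymbolPair p (θ ^ p - θ) (η ^ p)
      (LinearMap.mulLeft S fun i : ZMod p ↦ θ + ZMod.castHom dvd_rfl S i)
      (η • LinearMap.funLeft S S fun i : ZMod p ↦ i + 1) where
  artinSchreier := by
    ext f i
    have hi : i.cast ^ p = (i.cast : S) := by
      rw [← ZMod.castHom_apply (h := dvd_rfl), ← map_pow, ZMod.pow_card]
    simp only [LinearMap.pow_mulLeft, LinearMap.sub_apply, LinearMap.comp_apply,
      LinearMap.mulLeft_apply, Pi.sub_apply, Pi.mul_apply, Pi.pow_apply, ZMod.castHom_apply,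
      add_pow_char, hi, Module.algebraMap_end_apply, Pi.smul_apply, smul_eq_mul]
    ring
  pow_eq := by
    have hpow (n : ℕ) : (η • LinearMap.funLeft S S fun i : ZMod p ↦ i + 1) ^ n =
        η ^ n • LinearMap.funLeft S S fun i : ZMod p ↦ i + n := by
      induction n with
      | zero => ext; simp
      | succ n ih =>
        ext
        simp [pow_succ, ih, add_assoc, mul_assoc, mul_left_comm]
    ext
    simp [hpow, Module.algebraMap_end_apply, -map_pow]
  commutator := by
    ext f i
    simp
    ring

end ShiftRepresentation

lemma adjoin_mkAlgHom_ι_eq_top {R : Type*} [CommRing R]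
    (rel : FreeAlgebra R (Fin 2) → FreeAlgebra R (Fin 2) → Prop) :
    Algebra.adjoin R {RingQuot.mkAlgHom R rel (FreeAlgebra.ι R 0),
      RingQuot.mkAlgHom R rel (FreeAlgebra.ι R 1)} = ⊤ := by
  have hmap := (FreeAlgebra.adjoin_range_ι R (Fin 2)).symm ▸ Algebra.map_top
    (RingQuot.mkAlgHom R rel)
  rw [AlgHom.map_adjoin, (AlgHom.range_eq_top _).2 (RingQuot.mkAlgHom_surjective _ _),
    ← Set.range_comp] at hmap
  rw [← hmap]
  congr 1
  ext t
  simp [Fin.exists_fin_two, eq_comm]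

namespace SymbolAlg

section

variable (p : ℕ) (R : Type*) [CommRing R] (a b : R)

/-- The generator `u` of `[a, b)_{p, R}`, with `u ^ p - u = a`. -/
noncomputable def u : SymbolAlg p R a b := RingQuot.mkAlgHom R _ (FreeAlgebra.ι R 0)

/-- The generator `v` of `[a, b)_{p, R}`, with `v ^ p = b`. -/
noncomputable def v : SymbolAlg p R a b := RingQuot.mkAlgHom R _ (FreeAlgebra.ι R 1)

lemma isSymbolPair : IsSymbolPair p a b (u p R a b) (v p R a b) where
  artinSchreier := by
    simpa [u] using RingQuot.mkAlgHom_rel R (SymbolRel.artinSchreier (p := p) (a := a) (b := b))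
  pow_eq := by
    simpa [v] using RingQuot.mkAlgHom_rel R (SymbolRel.central (p := p) (a := a) (b := b))
  commutator := by
    simpa [u, v] using RingQuot.mkAlgHom_rel R (SymbolRel.commutator (p := p) (a := a) (b := b))

lemma adjoin_eq_top : Algebra.adjoin R {u p R a b, v p R a b} = ⊤ :=
  adjoin_mkAlgHom_ι_eq_top _

variable {p R a b} {B : Type*} [Ring B] [Algebra R B]

/-- The homomorphism from `[a, b)_{p, R}` determined by a symbol pair. -/
noncomputable def lift {U V : B} (h : IsSymbolPair p a b U V) : SymbolAlg p R a b →ₐ[R] B :=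
  RingQuot.liftAlgHom R ⟨FreeAlgebra.lift R ![U, V], by
    rintro _ _ ⟨⟩
    · simpa using h.artinSchreier
    · simpa using h.pow_eq
    · simpa using h.commutator⟩

end

variable {p : ℕ} [Fact p.Prime]

instance {R : Type*} [CommRing R] [CharP R p] (a b : R) : FaithfulSMul R (SymbolAlg p R a b) := by
  have := CharP.nontrivial_of_char_ne_one (R := R) (Fact.out : p.Prime).ne_one
  obtain ⟨S, _, _, _, θ, η, hθ, hη⟩ := exists_faithfulSMul_roots_symbol (p := p) a b
  have hRS := FaithfulSMul.algebraMap_injective R S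
  have : CharP S p := charP_of_injective_algebraMap hRS p
  have hpair := isSymbolPair_mulLeft_smul_funLeft (p := p) θ η
  rw [hθ, hη, isSymbolPair_algebraMap_iff] at hpair
  refine (faithfulSMul_iff_algebraMap_injective _ _).2 fun r r' hr ↦ hRS ?_
  have hlift := congrArg (lift hpair) hr
  rw [AlgHom.commutes, AlgHom.commutes] at hlift
  simpa [Module.algebraMap_end_apply, Algebra.algebraMap_eq_smul_one] using
    congrFun (LinearMap.congr_fun hlift 1) 0

instance {R : Type*} [CommRing R] [CharP R p] (a b : R) : Nontrivial (SymbolAlg p R a b) :=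
  have := CharP.nontrivial_of_char_ne_one (R := R) (Fact.out : p.Prime).ne_one
  (FaithfulSMul.algebraMap_injective R _).nontrivial

lemma isSandwichBasis {R : Type*} [CommRing R] [CharP R p] (a : R) {b : R} (hb : IsUnit b) :
    IsSandwichBasis R (symbolMonomial p (u p R a b) (v p R a b)) :=
  (isSymbolPair p R a b).isSandwichBasis hb (adjoin_eq_top p R a b)

section Field

variable {K : Type*} [Field K] [CharP K p] (a : K) {b : K} (hb : b ≠ 0)

include hb

lemma isSimpleRing : IsSimpleRing (SymbolAlg p K a b) :=
  (isSandwichBasis a hb.isUnit).isSimpleRing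

lemma finrank_eq : Module.finrank K (SymbolAlg p K a b) = p ^ 2 := by
  rw [(isSandwichBasis a hb.isUnit).finrank_eq]
  simp [sq]

lemma isCentral : Algebra.IsCentral K (SymbolAlg p K a b) where
  out z hz := by
    have hp := (Fact.out : p.Prime).pos
    have hz' : z ∈ Subring.center _ := hz
    rwa [(isSandwichBasis a hb.isUnit).center_eq_range_algebraMap (i := (⟨0, hp⟩, ⟨0, hp⟩))
      (by simp [symbolMonomial])] at hz'

end Field

end SymbolAlg

/-! ### Clifford pairs in characteristic three -/

section Commutators

attribute [local instance] LieRing.ofAssociativeRing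

variable {B : Type*} [Ring B]

lemma cube_add_of_three_eq_zero (h3 : (3 : B) = 0) (p q : B) :
    (p + q) ^ 3 = p ^ 3 + q ^ 3 + ⁅p, ⁅p, q⁆⁆ + ⁅q, ⁅q, p⁆⁆ := by
  have h : (p + q) ^ 3 =
      p ^ 3 + q ^ 3 + ⁅p, ⁅p, q⁆⁆ + ⁅q, ⁅q, p⁆⁆ + 3 * (p * q * p + q * p * q) := by
    simp only [Ring.lie_def]
    noncomm_ring
  rw [h, h3, zero_mul, add_zero]

lemma cube_add_of_commute (h3 : (3 : B) = 0) {p q : B} (h : Commute p q) :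
    (p + q) ^ 3 = p ^ 3 + q ^ 3 := by
  simp [cube_add_of_three_eq_zero h3, commute_iff_lie_eq.1 h, commute_iff_lie_eq.1 h.symm]

lemma lie_pow_of_commute {p q : B} (h : Commute q ⁅p, q⁆) (n : ℕ) :
    ⁅p, q ^ (n + 1)⁆ = (n + 1) • (q ^ n * ⁅p, q⁆) := by
  have leibniz (r : B) : ⁅p, q * r⁆ = ⁅p, q⁆ * r + q * ⁅p, r⁆ := by
    simp only [Ring.lie_def]
    noncomm_ring
  induction n with
  | zero => simp
  | succ n ih =>
    rw [pow_succ', leibniz, ih, ← (h.pow_left (n + 1)).eq, mul_smul_comm, ← mul_assoc,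
      ← pow_succ', succ_nsmul' _ (n + 1)]

end Commutators

section CliffordPair

attribute [local instance] LieRing.ofAssociativeRing

variable {F B : Type*} [Field F] [Ring B] [Algebra F B]

variable (F B) in
include F in
lemma three_eq_zero_of_algebra [CharP F 3] : (3 : B) = 0 := by
  have h3 : (3 : F) = 0 := mod_cast CharP.cast_eq_zero F 3
  rw [← map_ofNat (algebraMap F B) 3, h3, map_zero]

-- Restates `lie_smul` for the bracket of `Ring.instBracket`, on which it fails to rewrite.
lemma lie_smul_right (c : F) (p q : B) : ⁅p, c • q⁆ = c • ⁅p, q⁆ := lie_smul c p q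

@[simp] lemma lie_algebraMap_eq_zero (b : B) (c : F) : ⁅b, algebraMap F B c⁆ = 0 :=
  commute_iff_lie_eq.1 (Algebra.commute_algebraMap_right c b)

/-- Generators of an image of `C_Φ`: the identity `(a x + b y) ^ 3 = f(a, b)` in characteristic
three, written coefficient by coefficient. -/
structure IsCliffordPair (α β γ δ : F) (x y : B) : Prop where
  x_pow : x ^ 3 = algebraMap F B α
  y_pow : y ^ 3 = algebraMap F B δ
  lie_x_lie_x_y : ⁅x, ⁅x, y⁆⁆ = algebraMap F B β
  lie_y_lie_y_x : ⁅y, ⁅y, x⁆⁆ = algebraMap F B γ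

/-- The elements `x`, `z = y₁` and `w` of an image of `C_Φ`, with the relations that present it:
`x` and `z` generate a Weyl algebra over which `w` is central. -/
structure IsWeylTriple (α β γ δ : F) (x z w : B) : Prop where
  x_pow : x ^ 3 = algebraMap F B α
  lie_x_z : ⁅x, z⁆ = algebraMap F B β
  commute_w_x : Commute w x
  commute_w_z : Commute w z
  curve : (z ^ 3 - algebraMap F B (β ^ 3)) ^ 2 = w ^ 3 + algebraMap F B (CPhi.Δ α β γ δ)

variable {α β γ δ : F} {x y z w : B}

lemma lie_sq_of_lie_eq_algebraMap {p q : B} {c : F} (h : ⁅p, q⁆ = algebraMap F B c) :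
    ⁅p, q ^ 2⁆ = (2 * c) • q := by
  have hc : Commute q ⁅p, q⁆ := h ▸ Algebra.commute_algebraMap_right c q
  rw [lie_pow_of_commute hc 1, h, pow_one, ← Algebra.commutes, ← Algebra.smul_def,
    ← Nat.cast_smul_eq_nsmul F, smul_smul, Nat.cast_succ, Nat.cast_one, one_add_one_eq_two]

lemma lie_sq_add_smul_of_lie_eq_algebraMap (hxz : ⁅x, z⁆ = algebraMap F B β) :
    ⁅x, z ^ 2 + β • z⁆ = (2 * β) • z + algebraMap F B (β ^ 2) := by
  rw [lie_add, lie_sq_of_lie_eq_algebraMap hxz, lie_smul_right, hxz, Algebra.smul_def β,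
    pow_two β, map_mul]

variable [CharP F 3]

lemma isCliffordPair_iff : IsCliffordPair α β γ δ x y ↔ ∀ a b : F, (a • x + b • y) ^ 3 =
    algebraMap F B (α * a ^ 3 + β * a ^ 2 * b + γ * a * b ^ 2 + δ * b ^ 3) := by
  have expand (a b : F) : (a • x + b • y) ^ 3 = a ^ 3 • x ^ 3 + b ^ 3 • y ^ 3 +
      (a ^ 2 * b) • ⁅x, ⁅x, y⁆⁆ + (a * b ^ 2) • ⁅y, ⁅y, x⁆⁆ := by
    rw [cube_add_of_three_eq_zero (three_eq_zero_of_algebra F B)]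
    simp only [smul_pow, lie_smul_right, smul_lie, smul_smul]
    ring_nf
  simp_rw [expand, Algebra.algebraMap_eq_smul_one]
  constructor
  · rintro ⟨hx, hy, hxy, hyx⟩ a b
    simp only [hx, hy, hxy, hyx, Algebra.algebraMap_eq_smul_one]
    module
  · intro h
    have hx : x ^ 3 = α • 1 := by simpa using h 1 0
    have hy : y ^ 3 = δ • 1 := by simpa using h 0 1
    have h3 : (3 : F) = 0 := three_eq_zero_of_algebra F F
    have hadd := h 1 1
    have hsub := h 1 (-1)
    rw [hx, hy] at hadd hsub
    constructor <;> rw [Algebra.algebraMap_eq_smul_one]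
    · exact hx
    · exact hy
    · linear_combination (norm := module) (2 : F) • hadd - (2 : F) • hsub -
        h3 • ⁅x, ⁅x, y⁆⁆ + (β * h3) • (1 : B)
    · linear_combination (norm := module) (2 : F) • hadd + (2 : F) • hsub -
        h3 • ⁅y, ⁅y, x⁆⁆ + (γ * h3) • (1 : B)

lemma commute_cube_of_lie_eq_algebraMap {p q : B} {c : F} (h : ⁅p, q⁆ = algebraMap F B c) :
    Commute p (q ^ 3) := by
  have hc : Commute q ⁅p, q⁆ := h ▸ Algebra.commute_algebraMap_right c q
  rw [commute_iff_lie_eq, lie_pow_of_commute hc 2, ← Nat.cast_smul_eq_nsmul F, CharP.cast_eq_zero,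
    zero_smul]

lemma cube_smul_add_sq_add_smul (hx : x ^ 3 = algebraMap F B α)
    (hxz : ⁅x, z⁆ = algebraMap F B β) : (γ • x + (z ^ 2 + β • z)) ^ 3 =
      z ^ 6 + β ^ 3 • z ^ 3 + algebraMap F B (γ ^ 3 * α - γ ^ 2 * β ^ 2) := by
  have h3 := three_eq_zero_of_algebra F B
  have h3F : (3 : F) = 0 := three_eq_zero_of_algebra F F
  have hzq : Commute (z ^ 2 + β • z) z :=
    ((Commute.refl z).pow_left 2).add_left ((Commute.refl z).smul_left β)
  have hxq := lie_sq_add_smul_of_lie_eq_algebraMap hxz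
  have hq3 : (z ^ 2 + β • z) ^ 3 = z ^ 6 + β ^ 3 • z ^ 3 := by
    rw [cube_add_of_commute h3 (((Commute.refl z).pow_left 2).smul_right β), smul_pow, ← pow_mul]
  have hxxq : ⁅γ • x, ⁅γ • x, z ^ 2 + β • z⁆⁆ = algebraMap F B (2 * γ ^ 2 * β ^ 2) := by
    rw [smul_lie, smul_lie, lie_smul_right, hxq, lie_add, lie_smul_right, hxz,
      lie_algebraMap_eq_zero, add_zero, Algebra.algebraMap_eq_smul_one,
      Algebra.algebraMap_eq_smul_one]
    module
  have hqqx : ⁅z ^ 2 + β • z, ⁅z ^ 2 + β • z, γ • x⁆⁆ = 0 := by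
    rw [lie_smul_right, ← lie_skew _ x, hxq, lie_smul_right, lie_neg, lie_add, lie_smul_right,
      hzq.lie_eq, lie_algebraMap_eq_zero, smul_zero, add_zero, neg_zero, smul_zero]
  rw [cube_add_of_three_eq_zero h3, hq3, hxxq, hqqx, smul_pow, hx]
  simp only [Algebra.algebraMap_eq_smul_one]
  linear_combination (norm := module) (γ ^ 2 * β ^ 2 * h3F) • (1 : B)

-- When `β y = w - (γ x + z ^ 2 + β z)`, the equation of the curve thus amounts to `y ^ 3 = δ`.
lemma cubic_defect_eq_smul (hx : x ^ 3 = algebraMap F B α) (hxz : ⁅x, z⁆ = algebraMap F B β)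
    (hwx : Commute w x) (hwz : Commute w z) (hy : β • y = w - (γ • x + (z ^ 2 + β • z))) :
    w ^ 3 + algebraMap F B (CPhi.Δ α β γ δ) - (z ^ 3 - algebraMap F B (β ^ 3)) ^ 2 =
      β ^ 3 • (y ^ 3 - algebraMap F B δ) := by
  have h3 := three_eq_zero_of_algebra F B
  have h3F : (3 : F) = 0 := three_eq_zero_of_algebra F F
  have hwq : Commute w (γ • x + (z ^ 2 + β • z)) :=
    (hwx.smul_right γ).add_right ((hwz.pow_right 2).add_right (hwz.smul_right β))
  have hy3 : β ^ 3 • y ^ 3 = w ^ 3 - (γ • x + (z ^ 2 + β • z)) ^ 3 := by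
    rw [← smul_pow, hy, sub_eq_add_neg, cube_add_of_commute h3 hwq.neg_right,
      Odd.neg_pow (by decide), ← sub_eq_add_neg]
  have hz : (z ^ 3 - algebraMap F B (β ^ 3)) ^ 2 =
      z ^ 6 - (2 * β ^ 3) • z ^ 3 + algebraMap F B (β ^ 6) := by
    rw [(Algebra.commute_algebraMap_right (β ^ 3) (z ^ 3)).sub_sq, mul_assoc,
      ← Algebra.commutes, ← Algebra.smul_def, ← pow_mul, ← map_pow, ← pow_mul, two_mul,
      ← two_smul F, mul_smul, ← smul_comm]
  rw [smul_sub, hy3, cube_smul_add_sq_add_smul hx hxz, hz, CPhi.Δ]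
  simp only [Algebra.algebraMap_eq_smul_one]
  linear_combination (norm := module) (β ^ 3 * h3F) • z ^ 3

section

variable (h : IsCliffordPair α β γ δ x y) (hz : z = ⁅x, y⁆ + ⁅x, ⁅x, y⁆⁆)

include h hz

omit [CharP F 3]

lemma IsCliffordPair.lie_x_y : ⁅x, y⁆ = z - algebraMap F B β := by
  rw [hz, h.lie_x_lie_x_y, add_sub_cancel_right]

lemma IsCliffordPair.lie_x_z : ⁅x, z⁆ = algebraMap F B β := by
  rw [hz, lie_add, h.lie_x_lie_x_y, lie_algebraMap_eq_zero, add_zero]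

lemma IsCliffordPair.lie_y_z : ⁅y, z⁆ = algebraMap F B (-γ) := by
  rw [hz, lie_add, h.lie_x_lie_x_y, lie_algebraMap_eq_zero, add_zero, ← lie_skew x, lie_neg,
    h.lie_y_lie_y_x, map_neg]

variable [CharP F 3] (hw : w = β • (y + z) + γ • x + z ^ 2)

include hw

lemma IsCliffordPair.commute_w_x : Commute w x := by
  have h3 : (3 : F) = 0 := three_eq_zero_of_algebra F F
  refine (commute_iff_lie_eq.2 ?_).symm
  rw [hw, lie_add, lie_add, lie_smul_right, lie_smul_right, lie_add, lie_self, h.lie_x_y hz,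
    h.lie_x_z hz, lie_sq_of_lie_eq_algebraMap (h.lie_x_z hz)]
  linear_combination (norm := module) (β * h3) • z

lemma IsCliffordPair.commute_w_y : Commute w y := by
  have h3 : (3 : F) = 0 := three_eq_zero_of_algebra F F
  refine (commute_iff_lie_eq.2 ?_).symm
  rw [hw, lie_add, lie_add, lie_smul_right, lie_smul_right, lie_add, lie_self, ← lie_skew y x,
    h.lie_x_y hz, h.lie_y_z hz, lie_sq_of_lie_eq_algebraMap (h.lie_y_z hz)]
  simp only [Algebra.algebraMap_eq_smul_one]
  linear_combination (norm := module) (-γ * h3) • z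

theorem IsCliffordPair.isWeylTriple : IsWeylTriple α β γ δ x z w := by
  have hwx := h.commute_w_x hz hw
  have hwy := h.commute_w_y hz hw
  have hwz : Commute w z := by
    rw [← sub_add_cancel z, ← h.lie_x_y hz]
    exact ((hwx.mul_right hwy).sub_right (hwy.mul_right hwx)).add_right
      (Algebra.commute_algebraMap_right β w)
  refine ⟨h.x_pow, h.lie_x_z hz, hwx, hwz, ?_⟩
  have hy : β • y = w - (γ • x + (z ^ 2 + β • z)) := by
    rw [hw]
    module
  have hdefect := cubic_defect_eq_smul (δ := δ) h.x_pow (h.lie_x_z hz) hwx hwz hy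
  rw [h.y_pow, sub_self, smul_zero, sub_eq_zero] at hdefect
  exact hdefect.symm

end

section

variable (h : IsWeylTriple α β γ δ x z w) (hβ : β ≠ 0)
  (hy : β • y = w - (γ • x + (z ^ 2 + β • z)))

include h hβ hy

lemma IsWeylTriple.lie_x_y : ⁅x, y⁆ = z - algebraMap F B β := by
  have h3 : (3 : F) = 0 := three_eq_zero_of_algebra F F
  apply smul_right_injective B hβ
  simp only
  rw [← lie_smul_right, hy, lie_sub, lie_add, lie_smul_right, lie_self,
    lie_sq_add_smul_of_lie_eq_algebraMap h.lie_x_z, h.commute_w_x.symm.lie_eq]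
  simp only [Algebra.algebraMap_eq_smul_one]
  linear_combination (norm := module) (-β * h3) • z

omit [CharP F 3] in
lemma IsWeylTriple.lie_z_y : ⁅z, y⁆ = algebraMap F B γ := by
  apply smul_right_injective B hβ
  simp only
  rw [← lie_smul_right, hy, lie_sub, lie_add, lie_add, lie_smul_right, lie_smul_right, lie_self,
    h.commute_w_z.symm.lie_eq, ((Commute.refl z).pow_right 2).lie_eq, ← lie_skew, h.lie_x_z]
  simp only [Algebra.algebraMap_eq_smul_one]
  module

theorem IsWeylTriple.isCliffordPair : IsCliffordPair α β γ δ x y where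
  x_pow := h.x_pow
  y_pow := by
    have hdefect := cubic_defect_eq_smul (δ := δ) h.x_pow h.lie_x_z h.commute_w_x h.commute_w_z hy
    rw [← h.curve, sub_self, eq_comm] at hdefect
    exact sub_eq_zero.1 ((smul_eq_zero_iff_right (pow_ne_zero 3 hβ)).1 hdefect)
  lie_x_lie_x_y := by
    rw [h.lie_x_y hβ hy, lie_sub, h.lie_x_z, lie_algebraMap_eq_zero, sub_zero]
  lie_y_lie_y_x := by
    rw [← lie_skew y x, h.lie_x_y hβ hy, lie_neg, lie_sub, lie_algebraMap_eq_zero, sub_zero,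
      lie_skew, h.lie_z_y hβ hy]

end

section SymbolPair

variable {R : Type*} [CommRing R] [Algebra F R] [Algebra R B] [IsScalarTower F R B] {r s : R}
  {u v : B}

lemma cube_mul_of_lie_eq_algebraMap (h : ⁅x, z⁆ = algebraMap F B β) :
    (z * x) ^ 3 = z ^ 3 * x ^ 3 + β ^ 2 • (z * x) := by
  have h3 : (3 : F) = 0 := three_eq_zero_of_algebra F F
  have hxz (t : B) : x * (z * t) = z * (x * t) + β • t := by
    rw [Algebra.smul_def, ← h, Ring.lie_def]
    noncomm_ring
  simp only [pow_three, mul_assoc, hxz, mul_add, mul_smul_comm]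
  linear_combination (norm := module) (β * h3) • (z * (z * (x * x)))

theorem IsWeylTriple.isSymbolPair (h : IsWeylTriple α β γ δ x z w) (hβ : β ≠ 0)
    (hs : algebraMap R B s = z ^ 3 - algebraMap F B (β ^ 3)) :
    IsSymbolPair 3 (algebraMap F R (α * (β ^ 3)⁻¹) * (s + algebraMap F R (β ^ 3)))
      (algebraMap F R α) (β⁻¹ • (z * x)) x where
  artinSchreier := by
    rw [smul_pow, cube_mul_of_lie_eq_algebraMap h.lie_x_z, h.x_pow, map_mul, map_add, hs,
      ← IsScalarTower.algebraMap_apply, ← IsScalarTower.algebraMap_apply, sub_add_cancel,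
      ← Algebra.commutes, ← Algebra.smul_def, ← Algebra.smul_def]
    match_scalars <;> field_simp
    simp
  pow_eq := by rw [h.x_pow, ← IsScalarTower.algebraMap_apply]
  commutator := by
    rw [mul_smul_comm, smul_mul_assoc, ← smul_sub, inv_smul_eq_iff₀ hβ, Algebra.smul_def,
      ← h.lie_x_z, Ring.lie_def]
    noncomm_ring

lemma IsSymbolPair.cube_mul_sq (h3 : (3 : B) = 0) {a b : R} (h : IsSymbolPair 3 a b u v) :
    (u * v ^ 2) ^ 3 = algebraMap R B (a * b ^ 2) := by
  have hv (j : ℕ) : v ^ j * u = (u + j) * v ^ j := by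
    simpa using (h.semiconjBy_add_natCast 0 j).eq
  calc (u * v ^ 2) ^ 3 = u * (v ^ 2 * u) * (v ^ 2 * (u * v ^ 2)) := by noncomm_ring
    _ = u * (u + (2 : ℕ)) * (v ^ 4 * u) * v ^ 2 := by
      rw [hv]
      noncomm_ring
    _ = u * (u + (2 : ℕ)) * (u + (4 : ℕ)) * (v ^ 3) ^ 2 := by
      rw [hv]
      noncomm_ring
    _ = (u ^ 3 - u + 3 * (2 * u ^ 2 + 3 * u)) * (v ^ 3) ^ 2 := by
      push_cast
      noncomm_ring
    _ = algebraMap R B (a * b ^ 2) := by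
      rw [h3, zero_mul, add_zero, h.artinSchreier, h.pow_eq, map_mul, map_pow]

variable (hα : α ≠ 0) (hβ : β ≠ 0)
  (h : IsSymbolPair 3 (algebraMap F R (α * (β ^ 3)⁻¹) * (s + algebraMap F R (β ^ 3)))
    (algebraMap F R α) u v)

include hα hβ h

lemma IsSymbolPair.cube_weyl : ((β * α⁻¹) • (u * v ^ 2)) ^ 3 =
    algebraMap R B s + algebraMap F B (β ^ 3) := by
  rw [smul_pow, h.cube_mul_sq (three_eq_zero_of_algebra F B), ← map_pow,
    mul_right_comm, ← map_mul, Algebra.smul_def, IsScalarTower.algebraMap_apply F R B,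
    IsScalarTower.algebraMap_apply F R B, ← map_mul, ← mul_assoc, ← map_mul, ← map_add]
  rw [show (β * α⁻¹) ^ 3 * (α * (β ^ 3)⁻¹ * α ^ 2) = 1 by field_simp, map_one, one_mul]

theorem IsSymbolPair.isWeylTriple (hrs : s ^ 2 = r ^ 3 + algebraMap F R (CPhi.Δ α β γ δ)) :
    IsWeylTriple α β γ δ v ((β * α⁻¹) • (u * v ^ 2)) (algebraMap R B r) where
  x_pow := by rw [h.pow_eq, ← IsScalarTower.algebraMap_apply]
  lie_x_z := by
    have hv : ⁅v, u * v ^ 2⁆ = algebraMap F B α := by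
      calc ⁅v, u * v ^ 2⁆ = (v * u - u * v) * v ^ 2 := by
            rw [Ring.lie_def]
            noncomm_ring
        _ = algebraMap F B α := by
          rw [h.commutator, ← pow_succ', h.pow_eq, ← IsScalarTower.algebraMap_apply]
    rw [lie_smul_right, hv, Algebra.smul_def, ← map_mul, inv_mul_cancel_right₀ hα]
  commute_w_x := Algebra.commutes r v
  commute_w_z := Algebra.commutes r _
  curve := by
    rw [h.cube_weyl hα hβ, add_sub_cancel_right, ← map_pow, hrs, map_add, map_pow,
      ← IsScalarTower.algebraMap_apply]

end SymbolPair

end CliffordPair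

/-! ### The coordinate ring of the cubic curve -/

lemma subring_eq_top_of_adjoin_eq_top {R A : Type*} [CommRing R] [Ring A] [Algebra R A] {t : Set A}
    (ht : Algebra.adjoin R t = ⊤) {S : Subring A} (hRS : (algebraMap R A).range ≤ S)
    (htS : t ⊆ S) : S = ⊤ := by
  have hcl : Subring.closure (Set.range (algebraMap R A) ∪ t) = ⊤ := by
    rw [← Algebra.adjoin_eq_ring_closure, ht, Algebra.top_toSubring]
  exact top_le_iff.1 (hcl.ge.trans (Subring.closure_le.2 (Set.union_subset hRS htS)))

namespace cubicCurve

open WeierstrassCurve.Affine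

variable {F : Type*} [Field F] (D : F)

/-- The coordinate function `r` on `E_D`. -/
noncomputable def r : (cubicCurve D).CoordinateRing := CoordinateRing.mk _ (.C .X)

/-- The coordinate function `s` on `E_D`. -/
noncomputable def s : (cubicCurve D).CoordinateRing := CoordinateRing.mk _ .X

lemma polynomial_eq : (cubicCurve D).polynomial = .X ^ 2 - .C (.X ^ 3 + .C D) := by
  simp [WeierstrassCurve.Affine.polynomial, cubicCurve]

lemma s_sq : s D ^ 2 = r D ^ 3 + algebraMap F _ D := by
  have h : CoordinateRing.mk (cubicCurve D) (.X ^ 2 - .C (.X ^ 3 + .C D)) = 0 :=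
    polynomial_eq D ▸ AdjoinRoot.mk_self
  rw [map_sub, sub_eq_zero, Polynomial.C_add, Polynomial.C_pow] at h
  simpa only [map_pow, map_add] using! h

lemma adjoin_r_s_eq_top : Algebra.adjoin F {r D, s D} = ⊤ := by
  refine Subalgebra.toSubring_injective (subring_eq_top_of_adjoin_eq_top
    (AdjoinRoot.adjoinRoot_eq_top (f := (cubicCurve D).polynomial)) ?_ ?_)
  · rintro _ ⟨q, rfl⟩
    have hq : Polynomial.aeval (r D) q = algebraMap _ (cubicCurve D).CoordinateRing q :=
      (Polynomial.aeval_algebraMap_apply _ (.X : Polynomial F) q).trans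
        (by rw [Polynomial.aeval_X_left_apply])
    change algebraMap _ (cubicCurve D).CoordinateRing q ∈ Algebra.adjoin F {r D, s D}
    rw [← hq]
    exact Algebra.adjoin_mono (by simp) (Polynomial.aeval_mem_adjoin_singleton F (r D))
  · exact Set.singleton_subset_iff.2 (Algebra.subset_adjoin (Set.mem_insert_of_mem (r D) rfl))

variable {D} {K : Type*} [CommRing K] [Algebra F K]

lemma algHom_ext {B : Type*} [Semiring B] [Algebra F B]
    {f g : (cubicCurve D).CoordinateRing →ₐ[F] B} (hr : f (r D) = g (r D))
    (hs : f (s D) = g (s D)) : f = g :=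
  AlgHom.ext_of_adjoin_eq_top (adjoin_r_s_eq_top D) (by
    rintro _ (rfl | rfl)
    exacts [hr, hs])

/-- The homomorphism from the coordinate ring of `E_D` to `K` determined by a point of `E_D` with
coordinates in `K`. -/
noncomputable def lift {r₀ s₀ : K} (h : s₀ ^ 2 = r₀ ^ 3 + algebraMap F K D) :
    (cubicCurve D).CoordinateRing →ₐ[F] K :=
  AdjoinRoot.liftAlgHom _ (Polynomial.aeval r₀) s₀ (by
    rw [polynomial_eq, Polynomial.eval₂_sub, Polynomial.eval₂_pow, Polynomial.eval₂_C,
      Polynomial.eval₂_X, h]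
    simp)

section

variable {r₀ s₀ : K} (h : s₀ ^ 2 = r₀ ^ 3 + algebraMap F K D)

@[simp]
lemma lift_r : lift h (r D) = r₀ :=
  (AdjoinRoot.liftAlgHom_mk _ _ _ _ _).trans (by rw [Polynomial.eval₂_C]; simp)

@[simp]
lemma lift_s : lift h (s D) = s₀ :=
  (AdjoinRoot.liftAlgHom_mk _ _ _ _ _).trans (Polynomial.eval₂_X _ _)

include h in
lemma lift_surjective (hgen : Algebra.adjoin F {r₀, s₀} = ⊤) : Function.Surjective (lift h) := by
  rw [← AlgHom.range_eq_top, ← Algebra.map_top, ← adjoin_r_s_eq_top, AlgHom.map_adjoin,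
    Set.image_pair, lift_r, lift_s, hgen]

end

instance (p : ℕ) [CharP F p] : CharP (cubicCurve D).CoordinateRing p :=
  charP_of_injective_algebraMap (algebraMap F _).injective p

end cubicCurve

/-! ### The Clifford algebra as a symbol algebra over the coordinate ring -/

namespace CPhi

variable {F : Type*} [Field F] [CharP F 3] (α β γ δ : F)

lemma isCliffordPair : IsCliffordPair α β γ δ (x α β γ δ) (y α β γ δ) :=
  isCliffordPair_iff.2 fun a b ↦ by
    simpa [x, y] using! RingQuot.mkAlgHom_rel F (CliffordRel.rel (α := α) (β := β) (γ := γ)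
      (δ := δ) a b)

lemma isWeylTriple : IsWeylTriple α β γ δ (x α β γ δ) (y₁ α β γ δ) (w α β γ δ) :=
  (isCliffordPair α β γ δ).isWeylTriple rfl rfl

omit [CharP F 3] in
lemma adjoin_x_y_eq_top : Algebra.adjoin F {x α β γ δ, y α β γ δ} = ⊤ :=
  adjoin_mkAlgHom_ι_eq_top _

variable {α β γ δ} in
omit [CharP F 3] in
lemma mem_center_of_commute {c : CPhi α β γ δ} (hx : Commute c (x α β γ δ))
    (hy : Commute c (y α β γ δ)) : c ∈ Subalgebra.center F (CPhi α β γ δ) := by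
  refine Subalgebra.mem_center_iff.2 fun t ↦ ?_
  refine (Algebra.commute_of_mem_adjoin_of_forall_mem_commute (R := F)
    (adjoin_x_y_eq_top α β γ δ ▸ Algebra.mem_top : t ∈ Algebra.adjoin F _) ?_).symm
  rintro _ (rfl | rfl)
  exacts [hx, hy]

lemma w_mem_center : w α β γ δ ∈ Subalgebra.center F (CPhi α β γ δ) :=
  mem_center_of_commute ((isCliffordPair α β γ δ).commute_w_x rfl rfl)
    ((isCliffordPair α β γ δ).commute_w_y rfl rfl)

lemma y₁_cube_mem_center : y₁ α β γ δ ^ 3 ∈ Subalgebra.center F (CPhi α β γ δ) :=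
  mem_center_of_commute
    (commute_cube_of_lie_eq_algebraMap ((isCliffordPair α β γ δ).lie_x_z rfl)).symm
    (commute_cube_of_lie_eq_algebraMap ((isCliffordPair α β γ δ).lie_y_z rfl)).symm

/-- The homomorphism `r ↦ w`, `s ↦ y₁ ^ 3 - β ^ 3` from the coordinate ring of `E_Δ` to the center
of `C_Φ`. -/
noncomputable def coordinateHom :
    (cubicCurve (Δ α β γ δ)).CoordinateRing →ₐ[F] Subalgebra.center F (CPhi α β γ δ) :=
  cubicCurve.lift (r₀ := ⟨w α β γ δ, w_mem_center α β γ δ⟩)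
    (s₀ := ⟨y₁ α β γ δ ^ 3 - algebraMap F _ (β ^ 3),
      sub_mem (y₁_cube_mem_center α β γ δ) (Subalgebra.algebraMap_mem _ _)⟩)
    (Subtype.ext (isWeylTriple α β γ δ).curve)

lemma coordinateHom_r : coordinateHom α β γ δ (cubicCurve.r (Δ α β γ δ)) =
    ⟨w α β γ δ, w_mem_center α β γ δ⟩ := by
  rw [coordinateHom, cubicCurve.lift_r]

lemma coordinateHom_s : coordinateHom α β γ δ (cubicCurve.s (Δ α β γ δ)) =
    ⟨y₁ α β γ δ ^ 3 - algebraMap F _ (β ^ 3),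
      sub_mem (y₁_cube_mem_center α β γ δ) (Subalgebra.algebraMap_mem _ _)⟩ := by
  rw [coordinateHom, cubicCurve.lift_s]

noncomputable instance : Algebra (cubicCurve (Δ α β γ δ)).CoordinateRing (CPhi α β γ δ) :=
  ((Subalgebra.center F _).val.comp (coordinateHom α β γ δ)).toRingHom.toAlgebra' fun g t ↦
    (Subalgebra.mem_center_iff.1 (coordinateHom α β γ δ g).2 t).symm

lemma algebraMap_r : algebraMap _ (CPhi α β γ δ) (cubicCurve.r (Δ α β γ δ)) = w α β γ δ :=
  congrArg Subtype.val (coordinateHom_r α β γ δ)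

lemma algebraMap_s : algebraMap _ (CPhi α β γ δ) (cubicCurve.s (Δ α β γ δ)) =
    y₁ α β γ δ ^ 3 - algebraMap F _ (β ^ 3) :=
  congrArg Subtype.val (coordinateHom_s α β γ δ)

instance : IsScalarTower F (cubicCurve (Δ α β γ δ)).CoordinateRing (CPhi α β γ δ) :=
  .of_algebraMap_eq fun c ↦
    (congrArg Subtype.val ((coordinateHom α β γ δ).commutes c)).symm

variable {α β}

lemma isSymbolPair (hβ : β ≠ 0) :
    IsSymbolPair 3
      (algebraMap F _ (α * (β ^ 3)⁻¹) * (cubicCurve.s (Δ α β γ δ) + algebraMap F _ (β ^ 3)))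
      (algebraMap F _ α) (β⁻¹ • (y₁ α β γ δ * x α β γ δ)) (x α β γ δ) :=
  (isWeylTriple α β γ δ).isSymbolPair hβ (algebraMap_s α β γ δ)

lemma adjoin_symbolPair_eq_top (hα : α ≠ 0) (hβ : β ≠ 0) :
    Algebra.adjoin (cubicCurve (Δ α β γ δ)).CoordinateRing
      {β⁻¹ • (y₁ α β γ δ * x α β γ δ), x α β γ δ} = ⊤ := by
  set S := Algebra.adjoin (cubicCurve (Δ α β γ δ)).CoordinateRing
    {β⁻¹ • (y₁ α β γ δ * x α β γ δ), x α β γ δ}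
  have hx : x α β γ δ ∈ S := Algebra.subset_adjoin (by simp)
  have hsmul (c : F) {t : CPhi α β γ δ} (ht : t ∈ S) : c • t ∈ S := by
    rw [← algebraMap_smul (cubicCurve (Δ α β γ δ)).CoordinateRing c t]
    exact S.smul_mem ht _
  have hy₁ : y₁ α β γ δ ∈ S := by
    have hcube : (α⁻¹ * β) • (β⁻¹ • (y₁ α β γ δ * x α β γ δ) * x α β γ δ ^ 2) = y₁ α β γ δ := by
      rw [smul_mul_assoc, mul_assoc, ← pow_succ', (isWeylTriple α β γ δ).x_pow, smul_smul,
        ← Algebra.commutes, ← Algebra.smul_def, smul_smul]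
      simp [hα, hβ]
    exact hcube ▸ hsmul _ (mul_mem (Algebra.subset_adjoin (by simp)) (pow_mem hx 2))
  have hw : w α β γ δ ∈ S := algebraMap_r α β γ δ ▸ S.algebraMap_mem _
  have hy : y α β γ δ ∈ S := by
    have hwy : β⁻¹ • (w α β γ δ - γ • x α β γ δ - y₁ α β γ δ ^ 2) - y₁ α β γ δ = y α β γ δ := by
      rw [sub_eq_iff_eq_add, inv_smul_eq_iff₀ hβ, w, y₂]
      abel
    exact hwy ▸ sub_mem (hsmul _ (sub_mem (sub_mem hw (hsmul _ hx)) (pow_mem hy₁ 2))) hy₁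
  refine Subalgebra.toSubring_injective (subring_eq_top_of_adjoin_eq_top
    (adjoin_x_y_eq_top α β γ δ) ?_ (Set.pair_subset hx hy))
  rintro _ ⟨c, rfl⟩
  rw [IsScalarTower.algebraMap_apply F (cubicCurve (Δ α β γ δ)).CoordinateRing]
  exact S.algebraMap_mem _

theorem isSandwichBasis (hα : α ≠ 0) (hβ : β ≠ 0) :
    IsSandwichBasis (cubicCurve (Δ α β γ δ)).CoordinateRing
      (symbolMonomial 3 (β⁻¹ • (y₁ α β γ δ * x α β γ δ)) (x α β γ δ)) :=
  (isSymbolPair γ δ hβ).isSandwichBasis (hα.isUnit.map _) (adjoin_symbolPair_eq_top γ δ hα hβ)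

section Lift

variable {γ δ} {B : Type*} [Ring B] [Algebra F B] {X Y Z W : B}

/-- The homomorphism from `C_Φ` determined by a Clifford pair. -/
noncomputable def lift (h : IsCliffordPair α β γ δ X Y) : CPhi α β γ δ →ₐ[F] B :=
  RingQuot.liftAlgHom F ⟨FreeAlgebra.lift F ![X, Y], by
    rintro _ _ ⟨a, b⟩
    simpa using isCliffordPair_iff.1 h a b⟩

@[simp]
lemma lift_x (h : IsCliffordPair α β γ δ X Y) : lift h (x α β γ δ) = X := by
  simp [lift, x]

@[simp]
lemma lift_y (h : IsCliffordPair α β γ δ X Y) : lift h (y α β γ δ) = Y := by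
  simp [lift, y]

/-- The homomorphism from `C_Φ` determined by a Weyl triple `X, Z, W`. It sends `x, y₁, w` to
`X, Z, W`. -/
noncomputable def weylLift (h : IsWeylTriple α β γ δ X Z W) (hβ : β ≠ 0) :
    CPhi α β γ δ →ₐ[F] B :=
  lift (h.isCliffordPair hβ (smul_inv_smul₀ hβ (W - (γ • X + (Z ^ 2 + β • Z)))))

variable (h : IsWeylTriple α β γ δ X Z W) (hβ : β ≠ 0)

lemma weylLift_x : weylLift h hβ (x α β γ δ) = X :=
  lift_x _

lemma weylLift_y₁ : weylLift h hβ (y₁ α β γ δ) = Z := by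
  have hXY := smul_inv_smul₀ hβ (W - (γ • X + (Z ^ 2 + β • Z)))
  have hmap (a b : CPhi α β γ δ) : weylLift h hβ ⁅a, b⁆ = ⁅weylLift h hβ a, weylLift h hβ b⁆ := by
    simp only [Ring.lie_def, map_sub, map_mul]
  have hy : weylLift h hβ (y α β γ δ) = β⁻¹ • (W - (γ • X + (Z ^ 2 + β • Z))) := lift_y _
  rw [y₁, map_add, hmap, hmap, hmap, weylLift_x, hy, (h.isCliffordPair hβ hXY).lie_x_lie_x_y,
    h.lie_x_y hβ hXY, sub_add_cancel]

lemma weylLift_w : weylLift h hβ (w α β γ δ) = W := by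
  have hy : weylLift h hβ (y α β γ δ) = β⁻¹ • (W - (γ • X + (Z ^ 2 + β • Z))) := lift_y _
  rw [w, y₂, map_add, map_add, map_smul, map_smul, map_pow, map_add, weylLift_x, weylLift_y₁, hy,
    smul_add, smul_inv_smul₀ hβ]
  abel

end Lift

section SymbolPairLift

variable {γ δ} {R B : Type*} [CommRing R] [Algebra F R] [Ring B] [Algebra F B] [Algebra R B]
  [IsScalarTower F R B] {r s : R} {U V : B} (hα : α ≠ 0) (hβ : β ≠ 0)
  (hrs : s ^ 2 = r ^ 3 + algebraMap F R (Δ α β γ δ))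
  (h : IsSymbolPair 3 (algebraMap F R (α * (β ^ 3)⁻¹) * (s + algebraMap F R (β ^ 3)))
    (algebraMap F R α) U V)

/-- The homomorphism from `C_Φ` to an algebra over `R` determined by a point `(r, s)` of `E_Δ` with
coordinates in `R` and a symbol pair with the corresponding parameters. -/
noncomputable def symbolPairLift : CPhi α β γ δ →ₐ[F] B :=
  weylLift (h.isWeylTriple hα hβ hrs) hβ

lemma symbolPairLift_x : symbolPairLift hα hβ hrs h (x α β γ δ) = V :=
  weylLift_x _ hβ

lemma symbolPairLift_y₁ :
    symbolPairLift hα hβ hrs h (y₁ α β γ δ) = (β * α⁻¹) • (U * V ^ 2) :=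
  weylLift_y₁ _ hβ

lemma symbolPairLift_algebraMap (g : (cubicCurve (Δ α β γ δ)).CoordinateRing) :
    symbolPairLift hα hβ hrs h (algebraMap _ _ g) = algebraMap R _ (cubicCurve.lift hrs g) := by
  suffices (symbolPairLift hα hβ hrs h).comp (IsScalarTower.toAlgHom F _ (CPhi α β γ δ)) =
      (IsScalarTower.toAlgHom F R B).comp (cubicCurve.lift hrs) from DFunLike.congr_fun this g
  refine cubicCurve.algHom_ext ?_ ?_
  · simp only [AlgHom.comp_apply, IsScalarTower.coe_toAlgHom', algebraMap_r, cubicCurve.lift_r]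
    exact weylLift_w _ hβ
  · simp only [AlgHom.comp_apply, IsScalarTower.coe_toAlgHom', algebraMap_s, cubicCurve.lift_s]
    rw [map_sub, map_pow, symbolPairLift_y₁, h.cube_weyl hα hβ, AlgHom.commutes,
      add_sub_cancel_right]

lemma symbolPairLift_surjective (hrs_gen : Algebra.adjoin F {r, s} = ⊤)
    (hUV : Algebra.adjoin R {U, V} = ⊤) : Function.Surjective (symbolPairLift hα hβ hrs h) := by
  refine RingHom.range_eq_top (f := (symbolPairLift hα hβ hrs h).toRingHom).1
    (subring_eq_top_of_adjoin_eq_top hUV ?_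
      (Set.pair_subset ⟨β⁻¹ • (y₁ α β γ δ * x α β γ δ), ?_⟩ ⟨_, symbolPairLift_x hα hβ hrs h⟩))
  · rintro _ ⟨c, rfl⟩
    obtain ⟨g, rfl⟩ := cubicCurve.lift_surjective hrs hrs_gen c
    exact ⟨_, symbolPairLift_algebraMap hα hβ hrs h g⟩
  · change symbolPairLift hα hβ hrs h _ = U
    rw [map_smul, map_mul, symbolPairLift_x, symbolPairLift_y₁, smul_mul_assoc, mul_assoc,
      ← pow_succ, h.pow_eq, ← IsScalarTower.algebraMap_apply, ← Algebra.commutes,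
      ← Algebra.smul_def, smul_smul, smul_smul]
    simp [hα, hβ]

end SymbolPairLift

section Center

instance : FaithfulSMul (Subring.center (CPhi α β γ δ)) (CPhi α β γ δ) :=
  (faithfulSMul_iff_algebraMap_injective _ _).2 Subtype.val_injective

variable (hα : α ≠ 0) (hβ : β ≠ 0)

include hα hβ

lemma faithfulSMul : FaithfulSMul (cubicCurve (Δ α β γ δ)).CoordinateRing (CPhi α β γ δ) := by
  rw [faithfulSMul_iff_algebraMap_injective]
  intro g g' hg
  have hmap := congrArg
    (symbolPairLift hα hβ (cubicCurve.s_sq _) (SymbolAlg.isSymbolPair 3 _ _ _)) hg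
  have hid : cubicCurve.lift (cubicCurve.s_sq (Δ α β γ δ)) = AlgHom.id F _ :=
    cubicCurve.algHom_ext (cubicCurve.lift_r _) (cubicCurve.lift_s _)
  simpa only [symbolPairLift_algebraMap, hid, AlgHom.id_apply,
    (FaithfulSMul.algebraMap_injective _ _).eq_iff] using hmap

lemma center_eq_range_algebraMap : Subring.center (CPhi α β γ δ) =
    (algebraMap (cubicCurve (Δ α β γ δ)).CoordinateRing (CPhi α β γ δ)).range :=
  (isSandwichBasis γ δ hα hβ).center_eq_range_algebraMap (i := (0, 0)) (by simp [symbolMonomial])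

theorem coordinateHom_bijective : Function.Bijective (coordinateHom α β γ δ) := by
  have := faithfulSMul γ δ hα hβ
  refine ⟨fun g g' hg ↦ FaithfulSMul.algebraMap_injective _ (CPhi α β γ δ)
    (congrArg Subtype.val hg), ?_⟩
  rintro ⟨c, hc⟩
  obtain ⟨g, hg⟩ := (center_eq_range_algebraMap γ δ hα hβ).le hc
  exact ⟨g, Subtype.ext hg⟩

theorem center_eq_adjoin : Subalgebra.center F (CPhi α β γ δ) =
    Algebra.adjoin F {w α β γ δ, y₁ α β γ δ ^ 3} := by
  apply le_antisymm
  · rw [← Subalgebra.range_val (Subalgebra.center F (CPhi α β γ δ)), ← Algebra.map_top,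
      ← (AlgHom.range_eq_top _).2 (coordinateHom_bijective γ δ hα hβ).surjective,
      ← Algebra.map_top, ← cubicCurve.adjoin_r_s_eq_top, AlgHom.map_adjoin, AlgHom.map_adjoin,
      Set.image_pair, Set.image_pair, coordinateHom_r, coordinateHom_s, Algebra.adjoin_le_iff]
    exact Set.pair_subset (Algebra.subset_adjoin (by simp))
      (sub_mem (Algebra.subset_adjoin (by simp)) (Subalgebra.algebraMap_mem _ _))
  · exact Algebra.adjoin_le (Set.pair_subset (w_mem_center α β γ δ) (y₁_cube_mem_center α β γ δ))

lemma isSandwichBasis_center : IsSandwichBasis (Subring.center (CPhi α β γ δ))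
    (symbolMonomial 3 (β⁻¹ • (y₁ α β γ δ * x α β γ δ)) (x α β γ δ)) :=
  (isSandwichBasis γ δ hα hβ).of_range_algebraMap_le <| by
    rintro _ ⟨g, rfl⟩
    exact ⟨⟨_, (coordinateHom α β γ δ g).2⟩, rfl⟩

theorem isAzumaya : IsAzumaya (Subring.center (CPhi α β γ δ)) (CPhi α β γ δ) :=
  (isSandwichBasis_center γ δ hα hβ).isAzumaya

theorem rankAtStalk_eq (p : PrimeSpectrum (Subring.center (CPhi α β γ δ))) :
    Module.rankAtStalk (CPhi α β γ δ) p = 9 := by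
  simp [(isSandwichBasis_center γ δ hα hβ).rankAtStalk_eq p]

end Center

end CPhi

/-! ### Points of the cubic curve -/

lemma exists_algEquiv_comp_eq {F R K : Type*} [Field F] [CommRing R] [Algebra F R] [Field K]
    [Algebra F K] [Algebra.IsAlgebraic F K] [IsAlgClosed K] {f g : R →ₐ[F] K}
    (h : RingHom.ker f ≤ RingHom.ker g) : ∃ σ : K ≃ₐ[F] K, (σ : K →ₐ[F] K).comp f = g := by
  let τ : subalgebraEquivIntermediateField f.range →ₐ[F] K :=
    (Ideal.Quotient.liftₐ (RingHom.ker f) g fun _ hr ↦ h hr).comp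
      (Ideal.quotientKerEquivRange f).symm.toAlgHom
  obtain ⟨φ, hφ⟩ := IsAlgClosed.surjective_domRestrict_of_isAlgebraic (E := K) τ
  refine ⟨AlgEquiv.ofBijective φ (Algebra.IsAlgebraic.algHom_bijective φ), AlgHom.ext fun r ↦ ?_⟩
  have hr : (Ideal.quotientKerEquivRange f).symm (f.rangeRestrict r) = Ideal.Quotient.mk _ r :=
    (Ideal.quotientKerEquivRange f).symm_apply_eq.2 rfl
  calc φ (f r) = τ (f.rangeRestrict r) := DFunLike.congr_fun hφ (f.rangeRestrict r)
    _ = Ideal.Quotient.liftₐ (RingHom.ker f) g (fun _ hr ↦ h hr) (Ideal.Quotient.mk _ r) :=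
        congrArg (Ideal.Quotient.liftₐ (RingHom.ker f) g fun _ hr ↦ h hr) hr
    _ = g r := rfl

lemma exists_algHom_le_ker {F R : Type*} (K : Type*) [Field F] [CommRing R] [Algebra F R]
    [Algebra.FiniteType F R] [Field K] [Algebra F K] [IsAlgClosed K] {I : Ideal R} (hI : I ≠ ⊤) :
    ∃ f : R →ₐ[F] K, I ≤ RingHom.ker f := by
  obtain ⟨M, hM, hIM⟩ := I.exists_le_maximal hI
  let _ := Ideal.Quotient.field M
  have : Module.Finite F (R ⧸ M) := finite_of_finite_type_of_isJacobsonRing _ _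
  refine ⟨(IsAlgClosed.lift (R := F) (S := R ⧸ M) (M := K)).comp (Ideal.Quotient.mkₐ F M),
    fun r hr ↦ ?_⟩
  simp [RingHom.mem_ker, Ideal.Quotient.eq_zero_iff_mem.2 (hIM hr)]

namespace CubicPoint

variable {F : Type*} [Field F] {D : F} (P : CubicPoint D)

lemma curve : P.s₀ ^ 2 = P.r₀ ^ 3 + algebraMap F P.field D :=
  Subtype.ext P.eq

lemma adjoin_eq_top : Algebra.adjoin F {P.r₀, P.s₀} = ⊤ := by
  refine Subalgebra.map_injective (f := P.field.val) Subtype.val_injective ?_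
  rw [AlgHom.map_adjoin, Set.image_pair, Algebra.map_top]
  exact (IntermediateField.adjoin_toSubalgebra_of_isAlgebraic fun x _ ↦
    Algebra.IsAlgebraic.isAlgebraic x).symm.trans P.field.toSubalgebra.range_val.symm

/-- The evaluation of regular functions on `E_D` at a point. -/
noncomputable def eval : (cubicCurve D).CoordinateRing →ₐ[F] P.field :=
  cubicCurve.lift P.curve

lemma ker_val_comp_eval : RingHom.ker (P.field.val.comp P.eval) = RingHom.ker P.eval :=
  RingHom.ker_comp_of_injective _ P.field.val.injective

lemma val_comp_eval_smul (σ : AlgebraicClosure F ≃ₐ[F] AlgebraicClosure F) :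
    (σ • P).field.val.comp (σ • P).eval = (σ : _ →ₐ[F] _).comp (P.field.val.comp P.eval) :=
  cubicCurve.algHom_ext (by simp [eval, r₀]; rfl) (by simp [eval, s₀]; rfl)

lemma ker_eval_smul (σ : AlgebraicClosure F ≃ₐ[F] AlgebraicClosure F) :
    RingHom.ker (σ • P).eval = RingHom.ker P.eval := by
  rw [← ker_val_comp_eval, val_comp_eval_smul, ← ker_val_comp_eval]
  exact RingHom.ker_comp_of_injective _ σ.injective

variable {P} in
lemma exists_smul_eq {Q : CubicPoint D} (h : RingHom.ker P.eval ≤ RingHom.ker Q.eval) :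
    ∃ σ : AlgebraicClosure F ≃ₐ[F] AlgebraicClosure F, σ • P = Q := by
  rw [← ker_val_comp_eval, ← ker_val_comp_eval] at h
  obtain ⟨σ, hσ⟩ := exists_algEquiv_comp_eq h
  rw [← val_comp_eval_smul] at hσ
  have hr := DFunLike.congr_fun hσ (cubicCurve.r D)
  have hs := DFunLike.congr_fun hσ (cubicCurve.s D)
  refine ⟨σ, CubicPoint.ext ?_ ?_⟩
  · simpa [eval, r₀] using hr
  · simpa [eval, s₀] using hs

lemma exists_le_ker_eval {I : Ideal (cubicCurve D).CoordinateRing} (hI : I ≠ ⊤) :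
    ∃ P : CubicPoint D, I ≤ RingHom.ker P.eval := by
  have : Algebra.FiniteType F (cubicCurve D).CoordinateRing :=
    ⟨Subalgebra.fg_def.2 ⟨_, Set.toFinite _, cubicCurve.adjoin_r_s_eq_top D⟩⟩
  obtain ⟨f, hf⟩ := exists_algHom_le_ker (F := F) (AlgebraicClosure F) hI
  let P : CubicPoint D := ⟨f (cubicCurve.r D), f (cubicCurve.s D), by
    rw [← map_pow, cubicCurve.s_sq, map_add, map_pow, AlgHom.commutes]⟩
  have hP : f = P.field.val.comp P.eval :=
    cubicCurve.algHom_ext (by simp [eval, r₀, P]) (by simp [eval, s₀, P])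
  exact ⟨P, by rwa [← P.ker_val_comp_eval, ← hP]⟩

end CubicPoint

/-! ### The simple images of the Clifford algebra -/

/-- The isomorphism of the quotient by the kernel of a surjective algebra homomorphism with its
codomain. -/
noncomputable def quotientKerAlgEquiv {F A B : Type*} [CommRing F] [Ring A] [Ring B]
    [Algebra F A] [Algebra F B] (φ : A →ₐ[F] B) (hφ : Function.Surjective φ) :
    (TwoSidedIdeal.ker φ).ringCon.Quotient ≃ₐ[F] B :=
  .ofBijective (RingCon.liftₐ _ φ fun _ _ h ↦ h) (RingCon.lift_bijective_iff.2 ⟨rfl, hφ⟩)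

lemma eq_of_le_of_isSimpleRing_quotient {A : Type*} [Ring A] {I J : TwoSidedIdeal A}
    [IsSimpleRing I.ringCon.Quotient] [Nontrivial J.ringCon.Quotient] (h : I ≤ J) : I = J :=
  le_antisymm h fun a ha ↦ (RingCon.eq _).1 <|
    (RingCon.map _ _ (TwoSidedIdeal.ringCon_le_iff.1 h)).injective
      ((RingCon.eq J.ringCon).2 ha : ((a : A) : J.ringCon.Quotient) = (0 : A))

namespace CPhi

variable {F : Type*} [Field F] [CharP F 3] {α β γ δ : F}

instance (P : CubicPoint (Δ α β γ δ)) : CharP P.field 3 :=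
  charP_of_injective_algebraMap (algebraMap F P.field).injective 3

variable (hα : α ≠ 0) (hβ : β ≠ 0) (P Q : CubicPoint (Δ α β γ δ))

/-- The homomorphism of `C_Φ` onto the cyclic algebra attached to a point. -/
noncomputable def pointHom : CPhi α β γ δ →ₐ[F] pointAlg α β P :=
  symbolPairLift hα hβ P.curve (SymbolAlg.isSymbolPair 3 P.field _ _)

lemma pointHom_algebraMap (g : (cubicCurve (Δ α β γ δ)).CoordinateRing) :
    pointHom hα hβ P (algebraMap _ _ g) = algebraMap P.field _ (P.eval g) :=
  symbolPairLift_algebraMap hα hβ P.curve _ g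

lemma pointHom_w : pointHom hα hβ P (w α β γ δ) = algebraMap P.field _ P.r₀ := by
  rw [← algebraMap_r, pointHom_algebraMap, CubicPoint.eval, cubicCurve.lift_r]

lemma pointHom_y₁ : pointHom hα hβ P (y₁ α β γ δ ^ 3 - algebraMap F _ (β ^ 3)) =
    algebraMap P.field _ P.s₀ := by
  rw [← algebraMap_s, pointHom_algebraMap, CubicPoint.eval, cubicCurve.lift_s]

lemma pointHom_surjective : Function.Surjective (pointHom hα hβ P) :=
  symbolPairLift_surjective hα hβ P.curve _ P.adjoin_eq_top (SymbolAlg.adjoin_eq_top 3 P.field _ _)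

lemma isSimpleRing_quotient_ker_pointHom :
    IsSimpleRing (TwoSidedIdeal.ker (pointHom hα hβ P)).ringCon.Quotient :=
  .of_ringEquiv (quotientKerAlgEquiv _ (pointHom_surjective hα hβ P)).toRingEquiv.symm
    (SymbolAlg.isSimpleRing _ (by simpa using hα))

lemma algebraMap_mem_ker_pointHom {g : (cubicCurve (Δ α β γ δ)).CoordinateRing} :
    algebraMap _ _ g ∈ TwoSidedIdeal.ker (pointHom hα hβ P) ↔ g ∈ RingHom.ker P.eval := by
  rw [TwoSidedIdeal.mem_ker, pointHom_algebraMap, RingHom.mem_ker,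
    map_eq_zero_iff _ (algebraMap P.field _).injective]

variable {P Q} in
lemma ker_pointHom_le_iff :
    TwoSidedIdeal.ker (pointHom hα hβ P) ≤ TwoSidedIdeal.ker (pointHom hα hβ Q) ↔
      RingHom.ker P.eval ≤ RingHom.ker Q.eval := by
  constructor
  · intro h g hg
    rw [← algebraMap_mem_ker_pointHom hα hβ] at hg ⊢
    exact h hg
  · refine fun h ↦ (isSandwichBasis γ δ hα hβ).twoSidedIdeal_le fun g hg ↦ ?_
    rw [algebraMap_mem_ker_pointHom] at hg ⊢
    exact h hg

/-- The simple image of `C_Φ` attached to a point of `E_Δ`. -/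
noncomputable def pointImage : SimpleImage (CPhi α β γ δ) :=
  ⟨TwoSidedIdeal.ker (pointHom hα hβ P), isSimpleRing_quotient_ker_pointHom hα hβ P⟩

lemma pointImage_smul (σ : AlgebraicClosure F ≃ₐ[F] AlgebraicClosure F) :
    pointImage hα hβ (σ • P) = pointImage hα hβ P :=
  Subtype.ext (le_antisymm ((ker_pointHom_le_iff hα hβ).2 (P.ker_eval_smul σ).le)
    ((ker_pointHom_le_iff hα hβ).2 (P.ker_eval_smul σ).ge))

variable {P Q} in
lemma exists_smul_eq_of_pointImage_eq (h : pointImage hα hβ P = pointImage hα hβ Q) :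
    ∃ σ : AlgebraicClosure F ≃ₐ[F] AlgebraicClosure F, σ • P = Q :=
  CubicPoint.exists_smul_eq ((ker_pointHom_le_iff hα hβ).1 (congrArg Subtype.val h).le)

lemma pointImage_surjective : Function.Surjective (pointImage (γ := γ) (δ := δ) hα hβ) := by
  rintro ⟨I, hI⟩
  let q := I.ringCon.mk'.comp (algebraMap (cubicCurve (Δ α β γ δ)).CoordinateRing _)
  obtain ⟨P, hP⟩ := CubicPoint.exists_le_ker_eval (RingHom.ker_ne_top q)
  have := (pointImage hα hβ P).2
  refine ⟨P, Subtype.ext (eq_of_le_of_isSimpleRing_quotient ?_).symm⟩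
  exact (isSandwichBasis γ δ hα hβ).twoSidedIdeal_le fun g hg ↦
    (algebraMap_mem_ker_pointHom hα hβ P).2 (hP ((RingCon.eq _).2 hg))

/-- The bijection of the Galois orbits of points of `E_Δ` with the simple images of `C_Φ`. -/
noncomputable def orbitEquiv : CubicOrbit (Δ α β γ δ) ≃ SimpleImage (CPhi α β γ δ) :=
  .ofBijective
    (Quotient.lift (pointImage hα hβ) fun _ P ⟨σ, hσ⟩ ↦ hσ ▸ pointImage_smul hα hβ P σ)
    ⟨Quotient.ind₂ fun _ _ h ↦ Quotient.sound (exists_smul_eq_of_pointImage_eq hα hβ h.symm),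
      fun I ↦ (pointImage_surjective hα hβ I).imp' (Quotient.mk _) fun _ h ↦ h⟩

end CPhi

theorem mainTheorem6 {F : Type*} [Field F] [CharP F 3] (α β γ δ : F) (hα : α ≠ 0) (hβ : β ≠ 0) :
    -- (1) `C_Φ` is Azumaya (over its center) of constant rank 9
    (IsAzumaya (Subring.center (CPhi α β γ δ)) (CPhi α β γ δ) ∧
      ∀ p : PrimeSpectrum (Subring.center (CPhi α β γ δ)),
        Module.rankAtStalk (CPhi α β γ δ) p = 9) ∧
    -- (2) the center is `F[w, y₁ ^ 3]`, isomorphic to the coordinate ring of `E_Δ`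
    (Subalgebra.center F (CPhi α β γ δ) =
        Algebra.adjoin F {CPhi.w α β γ δ, CPhi.y₁ α β γ δ ^ 3} ∧
      ∃ e : (cubicCurve (CPhi.Δ α β γ δ)).CoordinateRing ≃ₐ[F]
          Subalgebra.center F (CPhi α β γ δ),
        (e (WeierstrassCurve.Affine.CoordinateRing.mk _ (Polynomial.C Polynomial.X)) :
          CPhi α β γ δ) = CPhi.w α β γ δ ∧
        (e (WeierstrassCurve.Affine.CoordinateRing.mk _ Polynomial.X) :
          CPhi α β γ δ) = CPhi.y₁ α β γ δ ^ 3 - algebraMap F (CPhi α β γ δ) (β ^ 3)) ∧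
    -- (3) Galois orbits of points of `E_Δ` correspond to simple images of `C_Φ`
    ∃ Ψ : CubicOrbit (CPhi.Δ α β γ δ) ≃ SimpleImage (CPhi α β γ δ),
      ∀ P : CubicPoint (CPhi.Δ α β γ δ),
        Algebra.IsCentral P.field (pointAlg α β P) ∧
        IsSimpleRing (pointAlg α β P) ∧
        Module.finrank P.field (pointAlg α β P) = 9 ∧
        ∃ e : (Ψ (Quotient.mk _ P)).1.ringCon.Quotient ≃ₐ[F] pointAlg α β P,
          e (CPhi.w α β γ δ : (Ψ (Quotient.mk _ P)).1.ringCon.Quotient) =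
            algebraMap P.field (pointAlg α β P) P.r₀ ∧
          e ((CPhi.y₁ α β γ δ ^ 3 - algebraMap F (CPhi α β γ δ) (β ^ 3) : CPhi α β γ δ) :
              (Ψ (Quotient.mk _ P)).1.ringCon.Quotient) =
            algebraMap P.field (pointAlg α β P) P.s₀ := by
  refine ⟨⟨CPhi.isAzumaya γ δ hα hβ, CPhi.rankAtStalk_eq γ δ hα hβ⟩,
    ⟨CPhi.center_eq_adjoin γ δ hα hβ,
      .ofBijective (CPhi.coordinateHom α β γ δ) (CPhi.coordinateHom_bijective γ δ hα hβ),
      congrArg Subtype.val (CPhi.coordinateHom_r α β γ δ),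
      congrArg Subtype.val (CPhi.coordinateHom_s α β γ δ)⟩,
    CPhi.orbitEquiv hα hβ, fun P ↦ ?_⟩
  have hα' : algebraMap F P.field α ≠ 0 := by simpa using hα
  exact ⟨SymbolAlg.isCentral _ hα', SymbolAlg.isSimpleRing _ hα', SymbolAlg.finrank_eq _ hα',
    quotientKerAlgEquiv _ (CPhi.pointHom_surjective hα hβ P), CPhi.pointHom_w hα hβ P,
    CPhi.pointHom_y₁ hα hβ P⟩
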